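/- **Theorem 1 (entangling operator representation of compound states).** *Setting.* Let $\mathcal A\subseteq\mathcal L(\mathcal G)$ and $\mathcal B\subseteq\mathcal L(\mathcal H)$ be von Neumann algebras with normal faithful semifinite traces $\mu$ and $\nu$. All Hilbert spaces below, except $\mathcal E,\mathcal F$, carry a conjugation (conjugate-linear isometric involution) $J$, and tensor products carry $J\otimes J$. Write $\tilde A=JA^\dagger J$, $\widetilde{\mathcal A}=\{\tilde A: A\in\mathcal A\}$, $\tilde\mu(\tilde A)=\mu(A)$, and similarly for $\mathcal B,\nu$. For a density $\rho$ affiliated with $\widetilde{\mathcal A}$ let $\langle A,\rho\rangle_\mu=\tilde\mu(\rho\tilde A)$, and likewise for $\nu$ and for $\langle A\otimes B,D\rangle=(\tilde\mu\otimes\tilde\nu)\bigl(D(\tilde A\otimes\tilde B)\bigr)$. Let $\upsilon:\mathcal G\otimes\mathcal H\to\mathcal E\otimes\mathcal F$ be a bounded operator with $\upsilon^\dagger\upsilon\in\widetilde{\mathcal A}\otimes\widetilde{\mathcal B}$ and $\langle I\otimes I,\upsilon^\dagger\upsilon\rangle=1$, and let $\omega$ be the normal state on $\mathcal A\otimes\mathcal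 B$ with $\omega(A\otimes B)=\langle A\otimes B,\upsilon^\dagger\upsilon\rangle$ for all $A\in\mathcal A$, $B\in\mathcal B$. *Auxiliary spaces.* Partial traces $\nu$ over a Hilbert space $\mathcal F_0$ make sense when $\mathcal F_0$ carries a representation of $\mathcal B'$ on which the trace $y^\dagger y\mapsto\nu(yy^\dagger)$, for bounded operators $y:\mathcal F_0\to\mathcal H$ intertwining $\mathcal B'$, is a sum of vector functionals; call $\mathcal F_0$ a *$\nu$-space*. Examples are $\mathcal H$ itself and, when $\mathcal B=\mathcal L(\mathcal H)$ with $\nu=\mathrm{Tr}$, any Hilbert space. Let $\mathcal F_0$ be a $\nu$-space, and $\mathcal E_0$ similarly a $\mu$-space. A vector $f\in\mathcal F_0$ is *$\nu$-bounded* if $\|yf\|^2\le C\,\nu(yy^\dagger)$ for some $C$ and all such $y$. An *amplitude* is a bounded operator $\varkappa':\mathcal G\otimes\mathcal H\to\mathcal E_0\otimes\mathcal F_0$ such that $J\varkappa'J$ intertwines the actions of $\mathcal A'$ and of $\mathcal B'$. An *entangling operator* with amplitude $\varkappa'$ is a densely defined closable operator $\varkappa:\mathcal G\otimes\mathcal F_0\to\mathcal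 E_0\otimes\mathcal H$, with domain the span of the vectors $\zeta\otimes f$ with $\zeta\in\mathcal G$ $\tilde\mu$-bounded and $f\in\mathcal F_0$ $\nu$-bounded, satisfying $$(\xi\otimes\eta')^\dagger\varkappa'(\zeta\otimes J\eta)=(\xi\otimes\eta)^\dagger\varkappa(\zeta\otimes J\eta')$$ for all $\xi\in\mathcal E_0$, $\eta\in\mathcal H$ and all $\zeta\in\mathcal G$, $\eta'\in\mathcal F_0$ with $\zeta\otimes J\eta'$ in the domain; put $\tilde\varkappa=J\varkappa^\dagger J$. It *achieves* $\omega$ if for all $A\in\mathcal A$, $B\in\mathcal B$ the partial traces $\nu(\varkappa^\dagger(I\otimes B)\varkappa)$ and $\mu(\tilde\varkappa^\dagger(A\otimes I)\tilde\varkappa)$ exist as (in general unbounded) densities affiliated with $\widetilde{\mathcal A}$ and $\widetilde{\mathcal B}$, lying in $\widetilde{\mathcal A}$, respectively $\widetilde{\mathcal B}$, when they are bounded, and $$\bigl\langle A,\nu(\varkappa^\dagger(I\otimes B)\varkappa)\bigr\rangle_\mu=\omega(A\otimes B)=\bigl\langle B,\mu(\tilde\varkappa^\dagger(A\otimes I)\tilde\varkappa)\bigr\rangle_\nu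 .$$ *Claim.* 1. There is an entangling operator $\varkappa:\mathcal G\otimes\mathcal H\to\mathcal G\otimes\mathcal H$ (with $\mathcal E_0=\mathcal G$, $\mathcal F_0=\mathcal H$) that achieves $\omega$, and its amplitude satisfies $\upsilon=U\varkappa'$ with a unitary operator $U$ from $\overline{\mathrm{ran}}\,\varkappa'$ onto $\overline{\mathrm{ran}}\,\upsilon$. 2. Let $\mathcal E_0$ be any $\mu$-space, $\mathcal F_0$ any $\nu$-space, and $\varkappa':\mathcal G\otimes\mathcal H\to\mathcal E_0\otimes\mathcal F_0$ any amplitude. If $\upsilon=U\varkappa'$ with a unitary $U$ from $\overline{\mathrm{ran}}\,\varkappa'$ onto $\overline{\mathrm{ran}}\,\upsilon$, then there is exactly one entangling operator $\varkappa$ with amplitude $\varkappa'$. An entangling operator $\varkappa$ with amplitude $\varkappa'$ achieves $\omega$ if and only if $\upsilon=U\varkappa'$ for such a unitary $U$. So $\varkappa$ is determined by $\upsilon=U\varkappa'$ uniquely up to a unitary operator on the (closed) range of $\upsilon$. -/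

import Mathlib

open scoped TensorProduct InnerProductSpace ENNReal NNReal

set_option linter.unusedSectionVars false

noncomputable section

namespace Entanglement

/-! ### Hilbert tensor products, operators on them, conjugations -/

section Tensor

variable {G H G₂ H₂ : Type*}
  [NormedAddCommGroup G] [InnerProductSpace ℂ G] [CompleteSpace G]
  [NormedAddCommGroup H] [InnerProductSpace ℂ H] [CompleteSpace H]
  [NormedAddCommGroup G₂] [InnerProductSpace ℂ G₂] [CompleteSpace G₂]
  [NormedAddCommGroup H₂] [InnerProductSpace ℂ H₂] [CompleteSpace H₂]

/-- The Hilbert space tensor product: the completion of the algebraic tensor product. -/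
abbrev HT (G H : Type*) [NormedAddCommGroup G] [InnerProductSpace ℂ G]
    [NormedAddCommGroup H] [InnerProductSpace ℂ H] : Type _ :=
  UniformSpace.Completion (G ⊗[ℂ] H)

/-- The product vector `g ⊗ h` of the Hilbert space tensor product. -/
def tp (g : G) (h : H) : HT G H := ((g ⊗ₜ[ℂ] h : G ⊗[ℂ] H) : HT G H)

theorem inner_map_map_adjoint (a : G →L[ℂ] G₂) (x y : G ⊗[ℂ] H) :
    ⟪TensorProduct.map (a : G →ₗ[ℂ] G₂) (LinearMap.id : H →ₗ[ℂ] H) x,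
      TensorProduct.map (a : G →ₗ[ℂ] G₂) (LinearMap.id : H →ₗ[ℂ] H) y⟫_ℂ =
    ⟪x, TensorProduct.map ((a.adjoint ∘L a : G →L[ℂ] G) : G →ₗ[ℂ] G)
      (LinearMap.id : H →ₗ[ℂ] H) y⟫_ℂ := by
  induction x using TensorProduct.induction_on with
  | zero => simp
  | add x₁ x₂ h₁ h₂ => simp only [map_add, inner_add_left, h₁, h₂]
  | tmul g h =>
    induction y using TensorProduct.induction_on with
    | zero => simp
    | add x₁ x₂ h₁ h₂ => simp only [map_add, inner_add_right, h₁, h₂]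
    | tmul g' h' => simp [ContinuousLinearMap.adjoint_inner_right]

theorem norm_map_id_le (a : G →L[ℂ] G₂) (x : G ⊗[ℂ] H) :
    ‖TensorProduct.map (a : G →ₗ[ℂ] G₂) (LinearMap.id : H →ₗ[ℂ] H) x‖ ≤ ‖a‖ * ‖x‖ := by
  set d : G →L[ℂ] G := ((‖a‖ ^ 2 : ℝ) : ℂ) • (1 : G →L[ℂ] G) - a.adjoint ∘L a with hd
  have hpos : 0 ≤ d := by
    rw [ContinuousLinearMap.nonneg_iff_isPositive, ContinuousLinearMap.isPositive_iff_complex]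
    intro v
    have e : ⟪d v, v⟫_ℂ = ((‖a‖ ^ 2 * ‖v‖ ^ 2 - ‖a v‖ ^ 2 : ℝ) : ℂ) := by
      simp only [hd, sub_apply, smul_apply,
        one_apply_eq_self, ContinuousLinearMap.comp_apply, inner_sub_left,
        inner_smul_left, ContinuousLinearMap.adjoint_inner_left, inner_self_eq_norm_sq_to_K]
      push_cast
      simp
    rw [e]
    refine ⟨rfl, ?_⟩
    have := a.le_opNorm v
    have h2 : ‖a v‖ ^ 2 ≤ (‖a‖ * ‖v‖) ^ 2 := by gcongr
    simp only [RCLike.re_to_complex, Complex.ofReal_re]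
    nlinarith
  set c : G →L[ℂ] G := CFC.sqrt d with hc
  have hcc : c.adjoint ∘L c = d := by
    have h1 : c.adjoint = c := by
      have : IsSelfAdjoint c := (CFC.sqrt_nonneg d).isSelfAdjoint
      exact this
    rw [h1]
    exact CFC.sqrt_mul_sqrt_self d hpos
  have key : ‖TensorProduct.map (a : G →ₗ[ℂ] G₂) (LinearMap.id : H →ₗ[ℂ] H) x‖ ^ 2
      + ‖TensorProduct.map (c : G →ₗ[ℂ] G) (LinearMap.id : H →ₗ[ℂ] H) x‖ ^ 2
      = ‖a‖ ^ 2 * ‖x‖ ^ 2 := by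
    have e1 := inner_map_map_adjoint a x x
    have e2 := inner_map_map_adjoint (H := H) c x x
    rw [hcc, hd, ContinuousLinearMap.toLinearMap_sub,
      ContinuousLinearMap.toLinearMap_smul] at e2
    rw [sub_eq_add_neg, TensorProduct.map_add_left, LinearMap.add_apply, inner_add_right,
      ← neg_one_smul ℂ ((a.adjoint ∘L a : G →L[ℂ] G) : G →ₗ[ℂ] G),
      TensorProduct.map_smul_left, TensorProduct.map_smul_left, LinearMap.smul_apply,
      LinearMap.smul_apply, inner_smul_right, inner_smul_right, ← e1] at e2
    have e3 : ((1 : G →L[ℂ] G) : G →ₗ[ℂ] G) = LinearMap.id := rfl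
    rw [e3, TensorProduct.map_id, LinearMap.id_apply] at e2
    have n1 := inner_self_eq_norm_sq_to_K (𝕜 := ℂ)
      (TensorProduct.map (a : G →ₗ[ℂ] G₂) (LinearMap.id : H →ₗ[ℂ] H) x)
    have n2 := inner_self_eq_norm_sq_to_K (𝕜 := ℂ)
      (TensorProduct.map (c : G →ₗ[ℂ] G) (LinearMap.id : H →ₗ[ℂ] H) x)
    have n3 := inner_self_eq_norm_sq_to_K (𝕜 := ℂ) x
    simp only [Complex.coe_algebraMap] at n1 n2 n3
    rw [n1, n2, n3] at e2
    have e4 : (((‖TensorProduct.map (a : G →ₗ[ℂ] G₂) (LinearMap.id : H →ₗ[ℂ] H) x‖ ^ 2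
      + ‖TensorProduct.map (c : G →ₗ[ℂ] G) (LinearMap.id : H →ₗ[ℂ] H) x‖ ^ 2 : ℝ)) : ℂ)
      = ((‖a‖ ^ 2 * ‖x‖ ^ 2 : ℝ) : ℂ) := by
      push_cast
      rw [e2]
      push_cast
      ring
    exact_mod_cast e4
  have h0 : 0 ≤ ‖a‖ * ‖x‖ := by positivity
  refine le_of_sq_le_sq ?_ h0
  nlinarith [sq_nonneg ‖TensorProduct.map (c : G →ₗ[ℂ] G) (LinearMap.id : H →ₗ[ℂ] H) x‖]

theorem norm_map_le (a : G →L[ℂ] G₂) (b : H →L[ℂ] H₂) (x : G ⊗[ℂ] H) :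
    ‖TensorProduct.map (a : G →ₗ[ℂ] G₂) (b : H →ₗ[ℂ] H₂) x‖ ≤ ‖a‖ * ‖b‖ * ‖x‖ := by
  have e : TensorProduct.map (a : G →ₗ[ℂ] G₂) (b : H →ₗ[ℂ] H₂) x =
      TensorProduct.map (a : G →ₗ[ℂ] G₂) (LinearMap.id : H₂ →ₗ[ℂ] H₂)
        (TensorProduct.comm ℂ H₂ G
          (TensorProduct.map (b : H →ₗ[ℂ] H₂) (LinearMap.id : G →ₗ[ℂ] G)
            (TensorProduct.comm ℂ G H x))) := by
    induction x using TensorProduct.induction_on with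
    | zero => simp
    | add x₁ x₂ h₁ h₂ => simp only [map_add, h₁, h₂]
    | tmul g h => simp
  rw [e, mul_assoc]
  refine (norm_map_id_le a _).trans ?_
  gcongr
  rw [TensorProduct.norm_comm]
  refine (norm_map_id_le b _).trans ?_
  rw [TensorProduct.norm_comm]

/-- The bounded operator `a ⊗ b` on Hilbert space tensor products. -/
def opT (a : G →L[ℂ] G₂) (b : H →L[ℂ] H₂) : HT G H →L[ℂ] HT G₂ H₂ :=
  ((TensorProduct.map (a : G →ₗ[ℂ] G₂) (b : H →ₗ[ℂ] H₂)).mkContinuous (‖a‖ * ‖b‖)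
    (norm_map_le a b)).completion

theorem opT_tp (a : G →L[ℂ] G₂) (b : H →L[ℂ] H₂) (g : G) (h : H) :
    opT a b (tp g h) = tp (a g) (b h) := by
  simp [opT, tp]

end Tensor

/-- A complex conjugation `J = J†`, `J² = 1`: a conjugate-linear isometric involution. -/
structure Conjugation (G : Type*) [NormedAddCommGroup G] [InnerProductSpace ℂ G] where
  /-- the underlying conjugate-linear map -/
  toMap : G →ₗ⋆[ℂ] G
  inner_map : ∀ x y, ⟪toMap x, toMap y⟫_ℂ = ⟪y, x⟫_ℂ
  invol : ∀ x, toMap (toMap x) = x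

section Conj

variable {G H E F : Type*}
  [NormedAddCommGroup G] [InnerProductSpace ℂ G] [CompleteSpace G]
  [NormedAddCommGroup H] [InnerProductSpace ℂ H] [CompleteSpace H]
  [NormedAddCommGroup E] [InnerProductSpace ℂ E] [CompleteSpace E]
  [NormedAddCommGroup F] [InnerProductSpace ℂ F] [CompleteSpace F]

instance : CoeFun (Conjugation G) (fun _ => G → G) := ⟨fun J => J.toMap⟩

theorem Conjugation.norm_map (J : Conjugation G) (x : G) : ‖J x‖ = ‖x‖ := by
  have h := J.inner_map x x
  rw [inner_self_eq_norm_sq_to_K, inner_self_eq_norm_sq_to_K] at h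
  have h2 : ‖J x‖ ^ 2 = ‖x‖ ^ 2 := by exact_mod_cast h
  exact (sq_eq_sq₀ (norm_nonneg _) (norm_nonneg _)).mp h2

/-- `J` as a continuous conjugate-linear map. -/
def Conjugation.toCLM (J : Conjugation G) : G →L⋆[ℂ] G :=
  J.toMap.mkContinuous 1 (fun x => by rw [one_mul]; exact (J.norm_map x).le)

theorem Conjugation.norm_tensor (J : Conjugation G) (J' : Conjugation H) (x : G ⊗[ℂ] H) :
    ‖TensorProduct.map J.toMap J'.toMap x‖ = ‖x‖ := by
  have key : ∀ x y : G ⊗[ℂ] H, ⟪TensorProduct.map J.toMap J'.toMap x,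
      TensorProduct.map J.toMap J'.toMap y⟫_ℂ = ⟪y, x⟫_ℂ := by
    intro x y
    induction x using TensorProduct.induction_on with
    | zero => simp
    | add x₁ x₂ h₁ h₂ => simp only [map_add, inner_add_left, inner_add_right, h₁, h₂]
    | tmul g h =>
      induction y using TensorProduct.induction_on with
      | zero => simp
      | add x₁ x₂ h₁ h₂ => simp only [map_add, inner_add_left, inner_add_right, h₁, h₂]
      | tmul g' h' => simp [J.inner_map, J'.inner_map]
  have h := key x x
  have n1 := inner_self_eq_norm_sq_to_K (𝕜 := ℂ) (TensorProduct.map J.toMap J'.toMap x)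
  have n2 := inner_self_eq_norm_sq_to_K (𝕜 := ℂ) x
  simp only [Complex.coe_algebraMap] at n1 n2
  rw [n1, n2] at h
  have h2 : ‖TensorProduct.map J.toMap J'.toMap x‖ ^ 2 = ‖x‖ ^ 2 := by exact_mod_cast h
  exact (sq_eq_sq₀ (norm_nonneg _) (norm_nonneg _)).mp h2

/-- The induced conjugation `J(g ⊗ h) = Jg ⊗ Jh` of the Hilbert space tensor product. -/
def conjT (J : Conjugation G) (J' : Conjugation H) : HT G H →L⋆[ℂ] HT G H :=
  ((TensorProduct.map J.toMap J'.toMap).mkContinuous 1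
    (fun x => by rw [one_mul]; exact (J.norm_tensor J' x).le)).completion

theorem conjT_tp (J : Conjugation G) (J' : Conjugation H) (g : G) (h : H) :
    conjT J J' (tp g h) = tp (J g) (J' h) := by
  simp [conjT, tp]

/-- The transposed operator `ã = J a† J`. -/
def tilde (J : Conjugation G) (a : G →L[ℂ] G) : G →L[ℂ] G :=
  J.toCLM.comp (a.adjoint.comp J.toCLM)

theorem tilde_apply (J : Conjugation G) (a : G →L[ℂ] G) (x : G) :
    tilde J a x = J (a.adjoint (J x)) := rfl

theorem tilde_tilde (J : Conjugation G) (a : G →L[ℂ] G) : tilde J (tilde J a) = a := by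
  have h : (tilde J a).adjoint = J.toCLM.comp (a.comp J.toCLM) := by
    symm
    rw [ContinuousLinearMap.eq_adjoint_iff]
    intro x y
    change ⟪J (a (J x)), y⟫_ℂ = ⟪x, J (a.adjoint (J y))⟫_ℂ
    rw [← J.invol y, J.inner_map, J.invol, ← ContinuousLinearMap.adjoint_inner_left,
      ← J.inner_map, J.invol]
  ext x
  rw [tilde_apply, h]
  change J (J (a (J (J x)))) = a x
  rw [J.invol, J.invol]

theorem tilde_mul (J : Conjugation G) (a b : G →L[ℂ] G) :
    tilde J (a * b) = tilde J b * tilde J a := by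
  ext x
  change J ((a * b).adjoint (J x)) = J (b.adjoint (J (J (a.adjoint (J x)))))
  rw [J.invol]
  have : (a * b).adjoint = b.adjoint * a.adjoint := star_mul a b
  rw [this]
  rfl

theorem tilde_star (J : Conjugation G) (a : G →L[ℂ] G) :
    tilde J (star a) = star (tilde J a) := by
  symm
  change (tilde J a).adjoint = tilde J a.adjoint
  symm
  rw [ContinuousLinearMap.eq_adjoint_iff]
  intro x y
  change ⟪J (a.adjoint.adjoint (J x)), y⟫_ℂ = ⟪x, J (a.adjoint (J y))⟫_ℂ
  rw [ContinuousLinearMap.adjoint_adjoint]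
  rw [← J.invol y, J.inner_map, J.invol, ← ContinuousLinearMap.adjoint_inner_left,
    ← J.inner_map, J.invol]

theorem tilde_add (J : Conjugation G) (a b : G →L[ℂ] G) :
    tilde J (a + b) = tilde J a + tilde J b := by
  ext x
  simp [tilde_apply]

theorem tilde_algebraMap (J : Conjugation G) (r : ℂ) :
    tilde J (algebraMap ℂ (G →L[ℂ] G) r) = algebraMap ℂ (G →L[ℂ] G) r := by
  ext x
  have : (algebraMap ℂ (G →L[ℂ] G) r).adjoint = algebraMap ℂ (G →L[ℂ] G) (star r) :=
    (algebraMap_star_comm r).symm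
  rw [tilde_apply, this]
  simp [Algebra.algebraMap_eq_smul_one, J.invol]

theorem centralizer_tilde (J : Conjugation G) (s : Set (G →L[ℂ] G)) :
    Set.centralizer (tilde J ⁻¹' s) = tilde J ⁻¹' Set.centralizer s := by
  ext x
  simp only [Set.mem_centralizer_iff, Set.mem_preimage]
  constructor
  · intro h m hm
    have := h (tilde J m) (by rwa [tilde_tilde])
    have := congrArg (tilde J) this
    rw [tilde_mul, tilde_mul, tilde_tilde] at this
    exact this.symm
  · intro h m hm
    have := h (tilde J m) hm
    have := congrArg (tilde J) this
    rw [tilde_mul, tilde_mul, tilde_tilde, tilde_tilde] at this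
    exact this.symm

/-- The transposed von Neumann algebra `Ã = {J a† J | a ∈ A}`; since the transposition is
involutive, `x ∈ Ã` means that `J x† J ∈ A`. -/
def transpose (J : Conjugation G) (A : VonNeumannAlgebra G) : VonNeumannAlgebra G where
  carrier := tilde J ⁻¹' (A : Set (G →L[ℂ] G))
  mul_mem' {x y} hx hy := by
    change tilde J (x * y) ∈ A
    rw [tilde_mul]
    exact mul_mem hy hx
  add_mem' {x y} hx hy := by
    change tilde J (x + y) ∈ A
    rw [tilde_add]
    exact add_mem hx hy
  algebraMap_mem' r := by
    change tilde J _ ∈ A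
    rw [tilde_algebraMap]
    exact A.algebraMap_mem' r
  star_mem' {x} hx := by
    change tilde J (star x) ∈ A
    rw [tilde_star]
    exact star_mem (S := VonNeumannAlgebra G) hx
  centralizer_centralizer' := by
    rw [centralizer_tilde, centralizer_tilde, VonNeumannAlgebra.centralizer_centralizer]

theorem mem_transpose (J : Conjugation G) (A : VonNeumannAlgebra G) (x : G →L[ℂ] G) :
    x ∈ transpose J A ↔ tilde J x ∈ A := Iff.rfl

/-- The von Neumann algebra tensor product `A ⊗ B` (as a set of operators): the bicommutant of
the operators `a ⊗ b`. -/
def vnTensor (A : VonNeumannAlgebra G) (B : VonNeumannAlgebra H) : Set (HT G H →L[ℂ] HT G H) :=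
  Set.centralizer (Set.centralizer {x | ∃ a ∈ A, ∃ b ∈ B, x = opT a b})

end Conj

/-! ### Traces -/

section Trace

universe u w

variable {H : Type u} [NormedAddCommGroup H] [InnerProductSpace ℂ H] [CompleteSpace H]
  {F : Type w} [NormedAddCommGroup F] [InnerProductSpace ℂ F] [CompleteSpace F]

/-- `ν` is a normal faithful semifinite trace on the von Neumann algebra `N`. Only the values of
`ν` on positive elements of `N` matter. Normality is expressed in the usual way by `ν` being a sum
of (normal) vector functionals. -/
structure IsNFSTrace (N : VonNeumannAlgebra H) (ν : (H →L[ℂ] H) → ℝ≥0∞) : Prop where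
  add : ∀ a ∈ N, ∀ b ∈ N, 0 ≤ a → 0 ≤ b → ν (a + b) = ν a + ν b
  smul : ∀ (r : ℝ≥0), ∀ a ∈ N, 0 ≤ a → ν (((r : ℝ) : ℂ) • a) = r * ν a
  tracial : ∀ x ∈ N, ν (star x * x) = ν (x * star x)
  faithful : ∀ a ∈ N, 0 ≤ a → ν a = 0 → a = 0
  semifinite : ∀ a ∈ N, 0 ≤ a → a ≠ 0 → ∃ b ∈ N, 0 ≤ b ∧ b ≤ a ∧ b ≠ 0 ∧ ν b < ∞
  normal : ∃ (κ : Type u) (h : κ → H), ∀ a ∈ N, 0 ≤ a →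
    ν a = ∑' i, ENNReal.ofReal (⟪h i, a (h i)⟫_ℂ).re

/-- The transposed trace `ν̃(x) = ν(x̃)` on the transposed algebra. -/
def tildeTrace (J : Conjugation H) (ν : (H →L[ℂ] H) → ℝ≥0∞) : (H →L[ℂ] H) → ℝ≥0∞ :=
  fun x => ν (tilde J x)

/-- A bounded operator `y : F → H` intertwines a representation `π` of the commutant `N'` on `F`
with the given action of `N'` on `H`. Then `y y† ∈ N`. For `F = H` with the given action the
intertwiners are just the elements of `N`. -/
def IsIntertwiner (N : VonNeumannAlgebra H)
    (π : N.commutant.toStarSubalgebra →⋆ₐ[ℂ] (F →L[ℂ] F)) (y : F →L[ℂ] H) : Prop :=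
  ∀ n : N.commutant.toStarSubalgebra, y ∘L π n = (n : H →L[ℂ] H) ∘L y

/-- The family `f` of vectors of `F` implements the trace `ν`, i.e.
`∑ⱼ ⟨fⱼ, y† y fⱼ⟩ = ν(y y†)` (`= ν(y† y)` if `F = H`) for all intertwiners `y : F → H`. -/
def IsTraceFamily (N : VonNeumannAlgebra H)
    (π : N.commutant.toStarSubalgebra →⋆ₐ[ℂ] (F →L[ℂ] F)) (ν : (H →L[ℂ] H) → ℝ≥0∞)
    {κ : Type*} (f : κ → F) : Prop :=
  ∀ y : F →L[ℂ] H, IsIntertwiner N π y → ∑' j, ‖y (f j)‖ₑ ^ 2 = ν (y ∘L y.adjoint)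

/-- The vector `f` of `F` is `ν`-bounded: its vector functional is dominated by a multiple of the
trace. -/
def IsTraceBounded (N : VonNeumannAlgebra H)
    (π : N.commutant.toStarSubalgebra →⋆ₐ[ℂ] (F →L[ℂ] F)) (ν : (H →L[ℂ] H) → ℝ≥0∞)
    (f : F) : Prop :=
  ∃ C : ℝ≥0, ∀ y : F →L[ℂ] H, IsIntertwiner N π y → ‖y f‖ₑ ^ 2 ≤ C * ν (y ∘L y.adjoint)

/-- The given representation of the commutant `N'` on `H` itself. -/
def stdRep (N : VonNeumannAlgebra H) : N.commutant.toStarSubalgebra →⋆ₐ[ℂ] (H →L[ℂ] H) :=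
  N.commutant.toStarSubalgebra.subtype

/-- The structure on an auxiliary Hilbert space `F` under which (partial) traces with respect to
`ν` can be taken over `F`: a representation of the commutant `N'` on `F`, such that the trace
induced by `ν` (through `y† y ↦ ν(y y†)` for intertwiners `y : F → H`) is implemented by vectors of
`F`. If `N` consists of all operators on `H ≠ 0`, with the usual trace, then every Hilbert space `F`
carries exactly one such structure, and it gives the usual trace over `F`. -/
structure AuxSpace (N : VonNeumannAlgebra H) (ν : (H →L[ℂ] H) → ℝ≥0∞)
    (F : Type w) [NormedAddCommGroup F] [InnerProductSpace ℂ F] [CompleteSpace F] where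
  /-- the representation of the commutant -/
  rep : N.commutant.toStarSubalgebra →⋆ₐ[ℂ] (F →L[ℂ] F)
  exists_family : ∃ (κ : Type w) (f : κ → F), IsTraceFamily N rep ν f

theorem mem_of_isIntertwiner_stdRep (N : VonNeumannAlgebra H) (y : H →L[ℂ] H)
    (hy : IsIntertwiner N (stdRep N) y) : y ∈ N := by
  rw [← N.commutant_commutant, VonNeumannAlgebra.mem_commutant_iff]
  intro n hn
  exact (hy ⟨n, hn⟩).symm

theorem IsNFSTrace.exists_family {N : VonNeumannAlgebra H} {ν : (H →L[ℂ] H) → ℝ≥0∞}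
    (hν : IsNFSTrace N ν) : ∃ (κ : Type u) (f : κ → H), IsTraceFamily N (stdRep N) ν f := by
  obtain ⟨κ, f, hf⟩ := hν.normal
  refine ⟨κ, f, fun y hy => ?_⟩
  have hyN := mem_of_isIntertwiner_stdRep N y hy
  have h1 : ν (y ∘L y.adjoint) = ν (star y * y) := (hν.tracial y hyN).symm
  rw [h1, hf _ (mul_mem (star_mem (S := VonNeumannAlgebra H) hyN) hyN) (star_mul_self_nonneg y)]
  refine tsum_congr fun j => ?_
  have h2 : ⟪f j, (star y * y) (f j)⟫_ℂ = ⟪y (f j), y (f j)⟫_ℂ :=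
    y.adjoint_inner_right (f j) (y (f j))
  rw [h2, inner_self_eq_norm_sq_to_K, ← ofReal_norm, ← ENNReal.ofReal_pow (norm_nonneg _)]
  congr 1
  norm_cast

/-- `H` itself as an auxiliary space; the traces over it are those given by `ν` on `N`. -/
def AuxSpace.std {N : VonNeumannAlgebra H} {ν : (H →L[ℂ] H) → ℝ≥0∞} (hν : IsNFSTrace N ν) :
    AuxSpace N ν H where
  rep := stdRep N
  exists_family := hν.exists_family

end Trace

/-! ### Densities, pairings, partial traces -/

section Pairing

universe u v w z

variable {G : Type u} [NormedAddCommGroup G] [InnerProductSpace ℂ G] [CompleteSpace G]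
  {H : Type v} [NormedAddCommGroup H] [InnerProductSpace ℂ H] [CompleteSpace H]
  {E : Type w} [NormedAddCommGroup E] [InnerProductSpace ℂ E] [CompleteSpace E]
  {F : Type z} [NormedAddCommGroup F] [InnerProductSpace ℂ F] [CompleteSpace F]

/-- `ω` is (the restriction to `M` of) a normal state on the von Neumann algebra `M`. -/
def IsNormalState (M : Set (H →L[ℂ] H)) (ω : (H →L[ℂ] H) → ℂ) : Prop :=
  ∃ (κ : Type v) (θ : κ → H), HasSum (fun i => ‖θ i‖ ^ 2) 1 ∧
    ∀ x ∈ M, HasSum (fun i => ⟪θ i, x (θ i)⟫_ℂ) (ω x)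

/-- `⟨a, R⟩ = ν̃(R ã) = c` for a density `R`, given as a sesquilinear form on the `ν̃`-bounded
vectors of `H`: computed by any family of vectors implementing the trace `ν̃`. -/
def HasPairing (J : Conjugation H) (N : VonNeumannAlgebra H) (ν : (H →L[ℂ] H) → ℝ≥0∞)
    (R : H → H → ℂ) (a : H →L[ℂ] H) (c : ℂ) : Prop :=
  ∀ (κ : Type v) (h : κ → H),
    IsTraceFamily (transpose J N) (stdRep (transpose J N)) (tildeTrace J ν) h →
    HasSum (fun i => R (h i) (tilde J a (h i))) c

/-- `⟨a ⊗ b, D⟩ = (μ̃ ⊗ ν̃)(D (ã ⊗ b̃)) = c` for a bounded operator `D` on `G ⊗ H`. -/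
def HasTensorPairing (JG : Conjugation G) (JH : Conjugation H)
    (A : VonNeumannAlgebra G) (μ : (G →L[ℂ] G) → ℝ≥0∞)
    (B : VonNeumannAlgebra H) (ν : (H →L[ℂ] H) → ℝ≥0∞)
    (D : HT G H →L[ℂ] HT G H) (a : G →L[ℂ] G) (b : H →L[ℂ] H) (c : ℂ) : Prop :=
  ∀ (ι : Type u) (g : ι → G) (κ : Type v) (h : κ → H),
    IsTraceFamily (transpose JG A) (stdRep (transpose JG A)) (tildeTrace JG μ) g →
    IsTraceFamily (transpose JH B) (stdRep (transpose JH B)) (tildeTrace JH ν) h →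
    HasSum (fun p : ι × κ => ⟪tp (g p.1) (h p.2),
      D (opT (tilde JG a) (tilde JH b) (tp (g p.1) (h p.2)))⟫_ℂ) c

/-- The form `R` on the `ν`-bounded vectors of `H` is a (generalized) density affiliated with `N`:
it commutes with the commutant of `N`, and if it is bounded then it is given by an element
of `N`. -/
structure IsDensity (N : VonNeumannAlgebra H) (ν : (H →L[ℂ] H) → ℝ≥0∞) (R : H → H → ℂ) :
    Prop where
  affiliated : ∀ n ∈ N.commutant, ∀ h' h, IsTraceBounded N (stdRep N) ν h' →
    IsTraceBounded N (stdRep N) ν h → R (n h') h = R h' (star n h)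
  mem_of_bounded : (∃ C : ℝ, ∀ h' h, IsTraceBounded N (stdRep N) ν h' →
      IsTraceBounded N (stdRep N) ν h → ‖R h' h‖ ≤ C * ‖h'‖ * ‖h‖) →
    ∃ r ∈ N, ∀ h' h, IsTraceBounded N (stdRep N) ν h' →
      IsTraceBounded N (stdRep N) ν h → R h' h = ⟪h', r h⟫_ℂ

/-- The value of a partially defined operator; only used on its domain. -/
def ev (T : HT G F →ₗ.[ℂ] HT E H) (x : HT G F) : HT E H := by
  classical
  exact if h : x ∈ T.domain then T ⟨x, h⟩ else 0

/-- The partially defined operator `c₂ S c₁` for conjugate-linear maps `c₁`, `c₂`. -/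
def conjPMap {K₁ K₂ : Type*} [NormedAddCommGroup K₁] [InnerProductSpace ℂ K₁]
    [NormedAddCommGroup K₂] [InnerProductSpace ℂ K₂]
    (c₁ : K₁ →L⋆[ℂ] K₁) (c₂ : K₂ →L⋆[ℂ] K₂) (S : K₁ →ₗ.[ℂ] K₂) : K₁ →ₗ.[ℂ] K₂ where
  domain := S.domain.comap (c₁ : K₁ →ₗ⋆[ℂ] K₁)
  toFun :=
    { toFun := fun x => c₂ (S ⟨c₁ x, x.2⟩)
      map_add' := fun x y => by
        rw [← map_add, ← LinearPMap.map_add]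
        congr 2
        exact Subtype.ext (map_add c₁ x.1 y.1)
      map_smul' := fun c x => by
        have h : (⟨c₁ (c • x : _), (c • x).2⟩ : S.domain) =
            (starRingEnd ℂ c) • ⟨c₁ x, x.2⟩ :=
          Subtype.ext (c₁.map_smulₛₗ c x.1)
        rw [h, LinearPMap.map_smul, ContinuousLinearMap.map_smulₛₗ]
        simp }

/-- The transposed operator `ϰ̃ = J ϰ† J` of a partially defined operator, on its maximal domain. -/
def transp (JG : Conjugation G) (JH : Conjugation H) (JE : Conjugation E) (JF : Conjugation F)
    (T : HT G F →ₗ.[ℂ] HT E H) : HT E H →ₗ.[ℂ] HT G F :=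
  conjPMap (conjT JE JH) (conjT JG JF) T.adjoint

variable (JG : Conjugation G) (JH : Conjugation H) (JE : Conjugation E) (JF : Conjugation F)
  {A : VonNeumannAlgebra G} {μ : (G →L[ℂ] G) → ℝ≥0∞}
  {B : VonNeumannAlgebra H} {ν : (H →L[ℂ] H) → ℝ≥0∞}
  (auxE : AuxSpace A μ E) (auxF : AuxSpace B ν F)

/-- The form `R` on the `μ̃`-bounded vectors of `G` is the partial trace `ν(ϰ† (1 ⊗ b) ϰ)` over
`F`. -/
def HasPartialTraceF (ϰ : HT G F →ₗ.[ℂ] HT E H) (b : H →L[ℂ] H) (R : G → G → ℂ) : Prop :=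
  ∀ (κ : Type z) (f : κ → F), IsTraceFamily B auxF.rep ν f →
    ∀ g' g : G,
      IsTraceBounded (transpose JG A) (stdRep (transpose JG A)) (tildeTrace JG μ) g' →
      IsTraceBounded (transpose JG A) (stdRep (transpose JG A)) (tildeTrace JG μ) g →
      HasSum (fun j => ⟪ev ϰ (tp g' (f j)),
        opT (ContinuousLinearMap.id ℂ E) b (ev ϰ (tp g (f j)))⟫_ℂ) (R g' g)

/-- The form `R` on the `ν̃`-bounded vectors of `H` is the partial trace `μ(ϰ̃† (a ⊗ 1) ϰ̃)` over
`E`. -/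
def HasPartialTraceE (ϰt : HT E H →ₗ.[ℂ] HT G F) (a : G →L[ℂ] G) (R : H → H → ℂ) : Prop :=
  ∀ (κ : Type w) (e : κ → E), IsTraceFamily A auxE.rep μ e →
    ∀ h' h : H,
      IsTraceBounded (transpose JH B) (stdRep (transpose JH B)) (tildeTrace JH ν) h' →
      IsTraceBounded (transpose JH B) (stdRep (transpose JH B)) (tildeTrace JH ν) h →
      HasSum (fun j => ⟪ev ϰt (tp (e j) h'),
        opT a (ContinuousLinearMap.id ℂ F) (ev ϰt (tp (e j) h))⟫_ℂ) (R h' h)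

/-- `K = ϰ'` is an amplitude operator `G ⊗ H → E ⊗ F` compatible with the auxiliary spaces: up to
the conjugations it intertwines the action of the commutants `A'`, `B'` on `G`, `H` with their
action on `E`, `F`. -/
def IsAmplitude (K : HT G H →L[ℂ] HT E F) : Prop :=
  ∀ (a : A.commutant.toStarSubalgebra) (b : B.commutant.toStarSubalgebra) (x : HT G H),
    conjT JE JF (K (conjT JG JH (opT (a : G →L[ℂ] G) (b : H →L[ℂ] H) x))) =
      opT (auxE.rep a) (auxF.rep b) (conjT JE JF (K (conjT JG JH x)))

/-- `ϰ : G ⊗ F → E ⊗ H` is the entangling operator with `ϰ' = K`: a densely defined closable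
operator on the span of the products of trace-bounded vectors, with
`(ξ ⊗ η')† ϰ' (ζ ⊗ Jη) = (ξ ⊗ η)† ϰ (ζ ⊗ Jη')`. -/
structure IsEntangling (K : HT G H →L[ℂ] HT E F) (ϰ : HT G F →ₗ.[ℂ] HT E H) : Prop where
  domain_eq : ϰ.domain = Submodule.span ℂ {x | ∃ (g : G) (f : F),
    IsTraceBounded (transpose JG A) (stdRep (transpose JG A)) (tildeTrace JG μ) g ∧
    IsTraceBounded B auxF.rep ν f ∧ x = tp g f}
  dense : Dense (ϰ.domain : Set (HT G F))
  closable : ϰ.IsClosable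
  rel : ∀ (ξ : E) (η' : F) (ζ : G) (η : H) (h : tp ζ (JF η') ∈ ϰ.domain),
    ⟪tp ξ η', K (tp ζ (JH η))⟫_ℂ = ⟪tp ξ η, ϰ ⟨tp ζ (JF η'), h⟩⟫_ℂ

/-- The compound state `ω` is achieved by the entangling operator `ϰ`:
`⟨a, ν(ϰ†(1 ⊗ b)ϰ)⟩ = ω(a ⊗ b) = ⟨b, μ(ϰ̃†(a ⊗ 1)ϰ̃)⟩` for all `a ∈ A`, `b ∈ B`, where the partial
traces are densities affiliated with `Ã` and `B̃`. -/
structure Achieves (ω : (HT G H →L[ℂ] HT G H) → ℂ) (ϰ : HT G F →ₗ.[ℂ] HT E H) : Prop where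
  left : ∀ b ∈ B, ∃ R : G → G → ℂ,
    HasPartialTraceF JG (A := A) (μ := μ) auxF ϰ b R ∧
    IsDensity (transpose JG A) (tildeTrace JG μ) R ∧
    ∀ a ∈ A, HasPairing JG A μ R a (ω (opT a b))
  transp_domain : ∀ (e : E) (h : H), IsTraceBounded A auxE.rep μ e →
    IsTraceBounded (transpose JH B) (stdRep (transpose JH B)) (tildeTrace JH ν) h →
    tp e h ∈ (transp JG JH JE JF ϰ).domain
  right : ∀ a ∈ A, ∃ R : H → H → ℂ,
    HasPartialTraceE JH (B := B) (ν := ν) auxE (transp JG JH JE JF ϰ) a R ∧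
    IsDensity (transpose JH B) (tildeTrace JH ν) R ∧
    ∀ b ∈ B, HasPairing JH B ν R b (ω (opT a b))

/-- `υ = U K` for a unitary operator `U` from the closure of the range of `K` onto the closure of
the range of `υ`. -/
def UnitaryRel {K₀ K₁ K₂ : Type*} [NormedAddCommGroup K₀] [InnerProductSpace ℂ K₀]
    [NormedAddCommGroup K₁] [InnerProductSpace ℂ K₁]
    [NormedAddCommGroup K₂] [InnerProductSpace ℂ K₂]
    (υ : K₀ →L[ℂ] K₁) (K : K₀ →L[ℂ] K₂) : Prop :=
  ∃ U : (LinearMap.range (K : K₀ →ₗ[ℂ] K₂)).topologicalClosure ≃ₗᵢ[ℂ]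
      (LinearMap.range (υ : K₀ →ₗ[ℂ] K₁)).topologicalClosure,
    ∀ x, (U ⟨K x, Submodule.le_topologicalClosure _ (LinearMap.mem_range_self _ x)⟩ : K₁) = υ x

end Pairing

end Entanglement

end

open Entanglement
open scoped ENNReal

/-!
An amplitude `K : G ⊗ H → E₀ ⊗ F₀` and an entangling operator `ϰ` determine each other by a partial
transposition: `ϰ(ζ ⊗ f)` is the vector of `E₀ ⊗ H` with
`(ξ ⊗ η)† ϰ(ζ ⊗ f) = (ξ ⊗ J f)† K(ζ ⊗ J η)`. The whole theorem rests on the fact that this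
transposition is isometric for the traces,
`∑ⱼ ‖ϰ(ζ ⊗ fⱼ)‖² = ∑ₗ ‖K(ζ ⊗ hₗ)‖²`,
where the families `f` in `F₀` and `h` in `H` implement `ν` and `ν̃` (`tsum_enorm_transpose`).
Expanding `E₀` along an orthonormal basis reduces this to the slices `k : H → F₀` of `K(ζ ⊗ ·)`. The
amplitude condition makes `y = J k† J : F₀ → H` an intertwiner of `B'`, and then both sides are
`ν(y y†) = ν̃(k† k)`. The same computation with a `ν`-bounded `f` in place of the family shows that
`ϰ(ζ ⊗ f)` exists (`exists_isTransposeAt`), and polarization gives the partial traces: the partial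
trace of `ϰ† (1 ⊗ b) ϰ` over `F₀` is the partial trace of `K† K (1 ⊗ b̃)` over `H`
(`hasSum_partialForm`). It is a density affiliated with `Ã` (`isDensity_partialForm`), and its
pairing with `a` is the pairing of `K† K` with `a ⊗ b`. Exchanging the tensor factors turns `K` into
an amplitude whose partial transposes describe `J ϰ† J` (`IsEntangling.transp_apply`), which gives
the other half of the statement that `ϰ` achieves the state with density `K† K`.

Uniqueness of `ϰ` is immediate. For existence, the partial transposes of `K` and of the exchanged
amplitude are formally adjoint to each other, and `ν`- and `μ`-bounded vectors are dense
(`dense_boundedVectors`), so the adjointness relations cut out the graph of a closed operator, of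
which `ϰ` is a restriction (`exists_isEntangling`).

Operators differ by a unitary between their closed ranges exactly if they have the same square
(`unitaryRel_iff`), so `υ = U K` means `K† K = υ† υ`. The first part follows with
`K = (υ† υ)^{1/2}`. For the converse in the second part, let `ϰ` achieve `ω`. Then
`T = K† K - υ† υ` has vanishing pairings with all `a ⊗ b`. Since `K† K` is not known to have
finite trace, only iterated sums are available, and the conclusion `T = 0` is drawn from them
(`eq_zero_of_pairing_eq_zero`): taking `b = w w'†` with `w`, `w'` of finite Hilbert-Schmidt norm,
cyclicity of the trace in the second factor produces a bounded element of the first algebra, which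
vanishes by faithfulness; the slices of `T` in the second algebra then vanish by faithfulness and
semifiniteness. Only the easy inclusion of the commutation theorem for tensor products is used: `T`
commutes with `n ⊗ m` for `n`, `m` in the commutants.
-/

open scoped TensorProduct InnerProductSpace ENNReal NNReal

noncomputable section

namespace Entanglement

/-! ### Product vectors, operators on tensor products, exchange of the factors -/

section TensorTools

variable {G H G₂ H₂ G₃ H₃ : Type*}
  [NormedAddCommGroup G] [InnerProductSpace ℂ G] [CompleteSpace G]
  [NormedAddCommGroup H] [InnerProductSpace ℂ H] [CompleteSpace H]
  [NormedAddCommGroup G₂] [InnerProductSpace ℂ G₂] [CompleteSpace G₂]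
  [NormedAddCommGroup H₂] [InnerProductSpace ℂ H₂] [CompleteSpace H₂]
  [NormedAddCommGroup G₃] [InnerProductSpace ℂ G₃] [CompleteSpace G₃]
  [NormedAddCommGroup H₃] [InnerProductSpace ℂ H₃] [CompleteSpace H₃]

theorem inner_tp (g g' : G) (h h' : H) :
    ⟪tp g h, tp g' h'⟫_ℂ = ⟪g, g'⟫_ℂ * ⟪h, h'⟫_ℂ := by
  simp [tp]

theorem norm_tp (g : G) (h : H) : ‖tp g h‖ = ‖g‖ * ‖h‖ := by
  simp [tp]

/-- The operator `h ↦ g ⊗ h`. -/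
def insL (g : G) : H →L[ℂ] HT G H :=
  LinearMap.mkContinuous
    ((UniformSpace.Completion.toComplL (𝕜 := ℂ) (E := G ⊗[ℂ] H)).toLinearMap ∘ₗ
      TensorProduct.mk ℂ G H g) ‖g‖ (fun h => (norm_tp g h).le)

/-- The operator `g ↦ g ⊗ h`. -/
def insR (h : H) : G →L[ℂ] HT G H :=
  LinearMap.mkContinuous
    ((UniformSpace.Completion.toComplL (𝕜 := ℂ) (E := G ⊗[ℂ] H)).toLinearMap ∘ₗ
      (TensorProduct.mk ℂ G H).flip h) ‖h‖ (fun g => by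
        rw [mul_comm]; exact (norm_tp g h).le)

theorem insL_apply (g : G) (h : H) : insL g h = tp g h := rfl

theorem insR_apply (g : G) (h : H) : insR h g = tp g h := rfl

theorem tp_add_left (g g' : G) (h : H) : tp (g + g') h = tp g h + tp g' h :=
  map_add (insR h) g g'

theorem tp_smul_left (c : ℂ) (g : G) (h : H) : tp (c • g) h = c • tp g h :=
  map_smul (insR h) c g

theorem insL_smul (c : ℂ) (g : G) : (insL (c • g) : H →L[ℂ] HT G H) = c • insL g := by
  ext h; exact tp_smul_left c g h

theorem norm_insR_le (h : H) : ‖(insR h : G →L[ℂ] HT G H)‖ ≤ ‖h‖ :=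
  LinearMap.mkContinuous_norm_le _ (norm_nonneg _) _

/-- Product vectors with factors from total sets form a total set. -/
theorem topologicalClosure_span_tp {s : Set G} {t : Set H}
    (hs : (Submodule.span ℂ s).topologicalClosure = ⊤)
    (ht : (Submodule.span ℂ t).topologicalClosure = ⊤) :
    (Submodule.span ℂ {x : HT G H | ∃ g ∈ s, ∃ h ∈ t, x = tp g h}).topologicalClosure = ⊤ := by
  set W := (Submodule.span ℂ {x : HT G H | ∃ g ∈ s, ∃ h ∈ t, x = tp g h}).topologicalClosure
    with hW
  have hWc : IsClosed (W : Set (HT G H)) := Submodule.isClosed_topologicalClosure _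
  have h1 : ∀ g ∈ s, ∀ h, tp g h ∈ W := by
    intro g hg h
    have : (⊤ : Submodule ℂ H) ≤ W.comap (insL g : H →L[ℂ] HT G H).toLinearMap := by
      rw [← ht]
      refine Submodule.topologicalClosure_minimal _ ?_ (hWc.preimage (insL g).continuous)
      rw [Submodule.span_le]
      intro h hh
      exact Submodule.le_topologicalClosure _ (Submodule.subset_span ⟨g, hg, h, hh, rfl⟩)
    exact this (Submodule.mem_top (x := h))
  have h2 : ∀ g h, tp g h ∈ W := by
    intro g h
    have : (⊤ : Submodule ℂ G) ≤ W.comap (insR h : G →L[ℂ] HT G H).toLinearMap := by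
      rw [← hs]
      refine Submodule.topologicalClosure_minimal _ ?_ (hWc.preimage (insR h).continuous)
      rw [Submodule.span_le]
      intro g hg
      exact h1 g hg h
    exact this (Submodule.mem_top (x := g))
  rw [eq_top_iff]
  intro x _
  refine UniformSpace.Completion.induction_on (p := fun x => x ∈ W) x hWc ?_
  intro y
  induction y using TensorProduct.induction_on with
  | zero => exact zero_mem W
  | add a b ha hb => rw [UniformSpace.Completion.coe_add]; exact add_mem ha hb
  | tmul g h => exact h2 g h

theorem topologicalClosure_span_univ :
    (Submodule.span ℂ (Set.univ : Set G)).topologicalClosure = ⊤ := by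
  rw [Submodule.span_univ, eq_top_iff]
  exact Submodule.le_topologicalClosure _

theorem dense_span_range_tp :
    Dense (Submodule.span ℂ {x : HT G H | ∃ g h, x = tp g h} : Set (HT G H)) := by
  rw [Submodule.dense_iff_topologicalClosure_eq_top]
  simpa using topologicalClosure_span_tp (G := G) (H := H) topologicalClosure_span_univ
    topologicalClosure_span_univ

theorem clm_ext_tp {X : Type*} [NormedAddCommGroup X] [NormedSpace ℂ X]
    {S T : HT G H →L[ℂ] X} (h : ∀ g h, S (tp g h) = T (tp g h)) : S = T := by
  refine ContinuousLinearMap.ext_on dense_span_range_tp ?_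
  rintro x ⟨g, k, rfl⟩
  exact h g k

theorem ext_inner_tp {x y : HT G H} (h : ∀ g h, ⟪tp g h, x⟫_ℂ = ⟪tp g h, y⟫_ℂ) : x = y := by
  rw [← sub_eq_zero, ← inner_self_eq_zero (𝕜 := ℂ)]
  have : innerSL ℂ (x - y) = (0 : HT G H →L[ℂ] ℂ) := by
    refine clm_ext_tp fun g k => ?_
    rw [innerSL_apply_apply, ← inner_conj_symm, inner_sub_right, h, sub_self]
    simp
  rw [← innerSL_apply_apply ℂ, this]
  rfl

theorem opT_id : opT (ContinuousLinearMap.id ℂ G) (ContinuousLinearMap.id ℂ H) =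
    ContinuousLinearMap.id ℂ (HT G H) :=
  clm_ext_tp fun g h => opT_tp _ _ g h

theorem opT_comp (a : G →L[ℂ] G₂) (b : H →L[ℂ] H₂) (a' : G₂ →L[ℂ] G₃) (b' : H₂ →L[ℂ] H₃) :
    opT a' b' ∘L opT a b = opT (a' ∘L a) (b' ∘L b) :=
  clm_ext_tp fun g h => by simp [opT_tp]

theorem opT_adjoint (a : G →L[ℂ] G₂) (b : H →L[ℂ] H₂) :
    (opT a b).adjoint = opT a.adjoint b.adjoint := by
  refine clm_ext_tp fun g h => ext_inner_tp fun g' h' => ?_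
  rw [ContinuousLinearMap.adjoint_inner_right, opT_tp, opT_tp, inner_tp, inner_tp,
    ContinuousLinearMap.adjoint_inner_right, ContinuousLinearMap.adjoint_inner_right]

theorem opT_insR (a : G →L[ℂ] G₂) (b : H →L[ℂ] H₂) (h : H) :
    opT a b ∘L insR h = insR (b h) ∘L a := by
  ext g; exact opT_tp a b g h

theorem opT_insL (a : G →L[ℂ] G₂) (b : H →L[ℂ] H₂) (g : G) :
    opT a b ∘L insL g = insL (a g) ∘L b := by
  ext h; exact opT_tp a b g h

theorem adjoint_insL_tp (e g : G) (h : H) : (insL e).adjoint (tp g h) = ⟪e, g⟫_ℂ • h := by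
  refine ext_inner_left ℂ fun v => ?_
  rw [ContinuousLinearMap.adjoint_inner_right, insL_apply, inner_tp, inner_smul_right]

theorem adjoint_insR_tp (e h : H) (g : G) : (insR e).adjoint (tp g h) = ⟪e, h⟫_ℂ • g := by
  refine ext_inner_left ℂ fun v => ?_
  rw [ContinuousLinearMap.adjoint_inner_right, insR_apply, inner_tp, inner_smul_right, mul_comm]

theorem adjoint_insL_opT (e : G) (b : H →L[ℂ] H₂) :
    (insL e).adjoint ∘L opT (ContinuousLinearMap.id ℂ G) b = b ∘L (insL e).adjoint :=
  clm_ext_tp fun g h => by simp [opT_tp, adjoint_insL_tp]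

/-- The exchange of the tensor factors. -/
def flipT (G H : Type*) [NormedAddCommGroup G] [InnerProductSpace ℂ G]
    [NormedAddCommGroup H] [InnerProductSpace ℂ H] : HT G H →L[ℂ] HT H G :=
  ((TensorProduct.comm ℂ G H).toLinearMap.mkContinuous 1
    (fun x => by rw [one_mul]; exact (TensorProduct.norm_comm x).le)).completion

theorem flipT_tp (g : G) (h : H) : flipT G H (tp g h) = tp h g := by
  simp [flipT, tp]

theorem flipT_flipT (x : HT G H) : flipT H G (flipT G H x) = x := by
  have : flipT H G ∘L flipT G H = ContinuousLinearMap.id ℂ (HT G H) :=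
    clm_ext_tp fun g h => by simp [flipT_tp]
  exact congrArg (fun T => T x) this

theorem adjoint_flipT : (flipT G H).adjoint = flipT H G := by
  refine clm_ext_tp fun h g => ext_inner_tp fun g' h' => ?_
  rw [ContinuousLinearMap.adjoint_inner_right, flipT_tp, flipT_tp, inner_tp, inner_tp, mul_comm]

theorem inner_flipT_flipT (x y : HT G H) : ⟪flipT G H x, flipT G H y⟫_ℂ = ⟪x, y⟫_ℂ := by
  rw [← ContinuousLinearMap.adjoint_inner_right, adjoint_flipT, flipT_flipT]

theorem norm_flipT (x : HT G H) : ‖flipT G H x‖ = ‖x‖ := by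
  have h := inner_flipT_flipT x x
  rw [inner_self_eq_norm_sq_to_K, inner_self_eq_norm_sq_to_K] at h
  have h2 : ‖flipT G H x‖ ^ 2 = ‖x‖ ^ 2 := by exact_mod_cast h
  exact (sq_eq_sq₀ (norm_nonneg _) (norm_nonneg _)).mp h2

theorem flipT_opT (a : G →L[ℂ] G₂) (b : H →L[ℂ] H₂) :
    flipT G₂ H₂ ∘L opT a b = opT b a ∘L flipT G H :=
  clm_ext_tp fun g h => by simp [opT_tp, flipT_tp]

/-! ### Decomposition of a tensor product along an orthonormal basis -/

section Basis

variable {κ : Type*} (e : HilbertBasis κ ℂ G)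

/-- For a unit vector `e`, the isometry `h ↦ e ⊗ h`. -/
def insLI (g : G) (hg : ‖g‖ = 1) : H →ₗᵢ[ℂ] HT G H where
  toLinearMap := (insL g : H →L[ℂ] HT G H)
  norm_map' h := (norm_tp g h).trans (by rw [hg, one_mul])

theorem isHilbertSum_insLI :
    IsHilbertSum ℂ (fun _ : κ => H) (fun k => insLI (H := H) (e k) (e.orthonormal.1 k)) := by
  refine IsHilbertSum.mk ?_ ?_
  · intro k k' hkk v w
    change ⟪tp (e k) v, tp (e k') w⟫_ℂ = 0
    rw [inner_tp, e.orthonormal.2 hkk, zero_mul]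
  · rw [← topologicalClosure_span_tp (G := G) (H := H) (s := Set.range e)
      (t := Set.univ) e.dense_span topologicalClosure_span_univ]
    refine Submodule.topologicalClosure_mono ?_
    rw [Submodule.span_le]
    rintro x ⟨_, ⟨k, rfl⟩, h, -, rfl⟩
    exact Submodule.mem_iSup_of_mem k ⟨h, rfl⟩

theorem isHilbertSum_equiv_apply (x : HT G H) (k : κ) :
    (isHilbertSum_insLI (H := H) e).linearIsometryEquiv x k = (insL (e k)).adjoint x := by
  classical
  refine ext_inner_left ℂ fun v => ?_
  rw [ContinuousLinearMap.adjoint_inner_right]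
  refine (lp.inner_single_left (𝕜 := ℂ) (G := fun _ : κ => H) k v _).symm.trans ?_
  rw [← (isHilbertSum_insLI (H := H) e).linearIsometryEquiv.symm.inner_map_map,
    LinearIsometryEquiv.symm_apply_apply, IsHilbertSum.linearIsometryEquiv_symm_apply_single]
  rfl

theorem hasSum_inner_slice (x y : HT G H) :
    HasSum (fun k => ⟪(insL (e k)).adjoint x, (insL (e k)).adjoint y⟫_ℂ) ⟪x, y⟫_ℂ := by
  have h := lp.hasSum_inner (𝕜 := ℂ) ((isHilbertSum_insLI (H := H) e).linearIsometryEquiv x)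
    ((isHilbertSum_insLI (H := H) e).linearIsometryEquiv y)
  simpa only [isHilbertSum_equiv_apply, LinearIsometryEquiv.inner_map_map] using h

/-- Parseval's identity for the slices `(eₖ ⊗ ·)† x` of a vector `x` of `G ⊗ H`. -/
theorem tsum_enorm_slice (x : HT G H) :
    ∑' k, ‖(insL (e k)).adjoint x‖ₑ ^ 2 = ‖x‖ₑ ^ 2 := by
  have h := (hasSum_inner_slice e x x).mapL (Complex.reCLM)
  have h' : HasSum (fun k => ‖(insL (e k)).adjoint x‖ ^ 2) (‖x‖ ^ 2) := by
    simpa [← Complex.ofReal_pow] using h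
  have := ENNReal.ofReal_tsum_of_nonneg (fun k => sq_nonneg _) h'.summable
  rw [h'.tsum_eq] at this
  simpa [ENNReal.ofReal_pow, ofReal_norm] using this.symm

/-- Square summable slices are the slices of a vector. -/
theorem exists_slice_eq (v : κ → H) (hv : ∑' k, ‖v k‖ₑ ^ 2 ≠ ∞) :
    ∃ x : HT G H, ∀ k, (insL (e k)).adjoint x = v k := by
  have hm : Memℓp v 2 := by
    refine memℓp_gen ?_
    have := ENNReal.summable_toReal hv
    simpa using this
  refine ⟨(isHilbertSum_insLI (H := H) e).linearIsometryEquiv.symm ⟨v, hm⟩, fun k => ?_⟩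
  rw [← isHilbertSum_equiv_apply, LinearIsometryEquiv.apply_symm_apply]

end Basis

end TensorTools

/-! ### Conjugated operators and the transposed algebra -/

section ConjTools

variable {G H E F : Type*}
  [NormedAddCommGroup G] [InnerProductSpace ℂ G] [CompleteSpace G]
  [NormedAddCommGroup H] [InnerProductSpace ℂ H] [CompleteSpace H]
  [NormedAddCommGroup E] [InnerProductSpace ℂ E] [CompleteSpace E]
  [NormedAddCommGroup F] [InnerProductSpace ℂ F] [CompleteSpace F]

theorem Conjugation.inner_left (J : Conjugation G) (x y : G) : ⟪J x, y⟫_ℂ = ⟪J y, x⟫_ℂ := by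
  rw [← J.inner_map, J.invol]

theorem Conjugation.inner_right (J : Conjugation G) (x y : G) : ⟪x, J y⟫_ℂ = ⟪y, J x⟫_ℂ := by
  rw [← J.inner_map, J.invol]

/-- The conjugated operator `J₂ T J₁`. -/
def conjOp (J₁ : Conjugation G) (J₂ : Conjugation H) (T : G →L[ℂ] H) : G →L[ℂ] H :=
  J₂.toCLM.comp (T.comp J₁.toCLM)

theorem conjOp_apply (J₁ : Conjugation G) (J₂ : Conjugation H) (T : G →L[ℂ] H) (x : G) :
    conjOp J₁ J₂ T x = J₂ (T (J₁ x)) := rfl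

theorem conjOp_conjOp (J₁ : Conjugation G) (J₂ : Conjugation H) (T : G →L[ℂ] H) :
    conjOp J₁ J₂ (conjOp J₁ J₂ T) = T := by
  ext x
  simp only [conjOp_apply, Conjugation.invol]

theorem conjOp_comp (J₁ : Conjugation G) (J₂ : Conjugation H) (J₃ : Conjugation E)
    (S : H →L[ℂ] E) (T : G →L[ℂ] H) :
    conjOp J₁ J₃ (S ∘L T) = conjOp J₂ J₃ S ∘L conjOp J₁ J₂ T := by
  ext x
  simp only [conjOp_apply, Conjugation.invol, ContinuousLinearMap.comp_apply]

theorem adjoint_conjOp (J₁ : Conjugation G) (J₂ : Conjugation H) (T : G →L[ℂ] H) :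
    (conjOp J₁ J₂ T).adjoint = conjOp J₂ J₁ T.adjoint := by
  symm
  rw [ContinuousLinearMap.eq_adjoint_iff]
  intro x y
  rw [conjOp_apply, conjOp_apply, J₁.inner_left, ContinuousLinearMap.adjoint_inner_right,
    ← J₂.inner_map, J₂.invol]

theorem tilde_eq_conjOp (J : Conjugation G) (a : G →L[ℂ] G) :
    tilde J a = conjOp J J a.adjoint := rfl

theorem adjoint_tilde (J : Conjugation G) (a : G →L[ℂ] G) :
    (tilde J a).adjoint = conjOp J J a := by
  rw [tilde_eq_conjOp, adjoint_conjOp, ContinuousLinearMap.adjoint_adjoint]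

theorem conjOp_one (J : Conjugation G) :
    conjOp J J (ContinuousLinearMap.id ℂ G) = ContinuousLinearMap.id ℂ G := by
  ext x
  exact J.invol x

theorem tilde_one (J : Conjugation G) : tilde J 1 = 1 := by
  have := tilde_algebraMap J 1
  rwa [map_one] at this

theorem tilde_zero (J : Conjugation G) : tilde J 0 = 0 := by
  have := tilde_algebraMap J 0
  rwa [map_zero] at this

theorem tilde_smul (J : Conjugation G) (c : ℂ) (a : G →L[ℂ] G) :
    tilde J (c • a) = c • tilde J a := by
  rw [Algebra.smul_def, tilde_mul, tilde_algebraMap, Algebra.smul_def, Algebra.commutes]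

theorem tilde_nonneg (J : Conjugation G) {a : G →L[ℂ] G} (ha : 0 ≤ a) : 0 ≤ tilde J a := by
  obtain ⟨s, rfl⟩ := CStarAlgebra.nonneg_iff_eq_star_mul_self.mp ha
  rw [tilde_mul, tilde_star]
  exact mul_star_self_nonneg _

theorem tilde_mono (J : Conjugation G) {a b : G →L[ℂ] G} (h : a ≤ b) :
    tilde J a ≤ tilde J b := by
  have h1 := tilde_nonneg J (sub_nonneg.mpr h)
  have h2 : tilde J b = tilde J (b - a) + tilde J a := by rw [← tilde_add, sub_add_cancel]
  rw [h2]
  exact le_add_of_nonneg_left h1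

theorem conjOp_mem_commutant (J : Conjugation G) (A : VonNeumannAlgebra G) {n : G →L[ℂ] G}
    (hn : n ∈ (transpose J A).commutant) : conjOp J J n ∈ A.commutant := by
  have h1 : n ∈ tilde J ⁻¹' Set.centralizer (A : Set (G →L[ℂ] G)) := by
    rw [← centralizer_tilde]
    have := hn
    rw [← SetLike.mem_coe, VonNeumannAlgebra.coe_commutant] at this
    exact this
  have h2 : tilde J n ∈ A.commutant := by
    rw [← SetLike.mem_coe, VonNeumannAlgebra.coe_commutant]
    exact h1
  rw [← adjoint_tilde]
  exact star_mem (S := VonNeumannAlgebra G) h2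

theorem conjOp_mem_commutant_transpose (J : Conjugation G) (A : VonNeumannAlgebra G)
    {n : G →L[ℂ] G} (hn : n ∈ A.commutant) : conjOp J J n ∈ (transpose J A).commutant := by
  have h1 : tilde J (conjOp J J n) ∈ A.commutant := by
    rw [tilde_eq_conjOp, adjoint_conjOp, conjOp_conjOp]
    exact star_mem (S := VonNeumannAlgebra G) hn
  rw [← SetLike.mem_coe, VonNeumannAlgebra.coe_commutant] at h1 ⊢
  change conjOp J J n ∈ Set.centralizer (tilde J ⁻¹' (A : Set (G →L[ℂ] G)))
  rw [centralizer_tilde]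
  exact h1

/-- By the bicommutant theorem and `(Ã)' = J A' J`, commuting with all `J n J`, `n ∈ A'`, puts an
operator into the transposed algebra. -/
theorem mem_transpose_of_comm (J : Conjugation G) (A : VonNeumannAlgebra G) {x : G →L[ℂ] G}
    (hx : ∀ n ∈ A.commutant, conjOp J J n ∘L x = x ∘L conjOp J J n) : x ∈ transpose J A := by
  rw [← (transpose J A).commutant_commutant, VonNeumannAlgebra.mem_commutant_iff]
  intro n hn
  have := hx _ (conjOp_mem_commutant J A hn)
  rwa [conjOp_conjOp] at this

theorem conjT_conjT (J₁ : Conjugation G) (J₂ : Conjugation H) (x : HT G H) :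
    conjT J₁ J₂ (conjT J₁ J₂ x) = x := by
  have : ((conjT J₁ J₂).comp (conjT J₁ J₂) : HT G H →L[ℂ] HT G H) =
      ContinuousLinearMap.id ℂ (HT G H) := by
    refine clm_ext_tp fun g h => ?_
    simp [conjT_tp, J₁.invol, J₂.invol]
  exact congrArg (fun T => T x) this

theorem conjT_opT (J₁ : Conjugation G) (J₂ : Conjugation H) (J₃ : Conjugation E)
    (J₄ : Conjugation F) (a : G →L[ℂ] E) (b : H →L[ℂ] F) (x : HT G H) :
    conjT J₃ J₄ (opT a b (conjT J₁ J₂ x)) = opT (conjOp J₁ J₃ a) (conjOp J₂ J₄ b) x := by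
  have : ((conjT J₃ J₄).comp ((opT a b).comp (conjT J₁ J₂)) : HT G H →L[ℂ] HT E F) =
      opT (conjOp J₁ J₃ a) (conjOp J₂ J₄ b) := by
    refine clm_ext_tp fun g h => ?_
    simp [conjT_tp, opT_tp, conjOp_apply]
  exact congrArg (fun T => T x) this

theorem inner_conjT (J₁ : Conjugation G) (J₂ : Conjugation H) (x : HT G H) (g : G) (h : H) :
    ⟪tp g h, conjT J₁ J₂ x⟫_ℂ = ⟪x, tp (J₁ g) (J₂ h)⟫_ℂ := by
  have : (innerSL ℂ (tp (J₁ g) (J₂ h)) : HT G H →L[ℂ] ℂ) =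
      ((starL ℂ).toContinuousLinearMap.comp
        (((innerSL ℂ (tp g h) : HT G H →L[ℂ] ℂ).comp (conjT J₁ J₂)))) := by
    refine clm_ext_tp fun g' h' => ?_
    simp only [innerSL_apply_apply, ContinuousLinearMap.comp_apply, conjT_tp, inner_tp]
    rw [J₁.inner_left, J₂.inner_left]
    simp only [ContinuousLinearEquiv.coe_coe, starL_apply, RCLike.star_def, map_mul, inner_conj_symm]
  have h2 := congrArg (fun T => T x) this
  simp only [innerSL_apply_apply, ContinuousLinearMap.comp_apply, ContinuousLinearEquiv.coe_coe,
    starL_apply] at h2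
  rw [← inner_conj_symm x, h2]
  simp

end ConjTools

/-! ### Transposed traces -/

section TraceTools

universe u w

variable {H : Type u} [NormedAddCommGroup H] [InnerProductSpace ℂ H] [CompleteSpace H]

theorem isNFSTrace_transpose {N : VonNeumannAlgebra H} {ν : (H →L[ℂ] H) → ℝ≥0∞}
    (J : Conjugation H) (hν : IsNFSTrace N ν) :
    IsNFSTrace (transpose J N) (tildeTrace J ν) where
  add a ha b hb h0 h1 := by
    simp only [tildeTrace, tilde_add]
    exact hν.add _ ha _ hb (tilde_nonneg J h0) (tilde_nonneg J h1)
  smul r a ha h0 := by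
    simp only [tildeTrace, tilde_smul]
    exact hν.smul r _ ha (tilde_nonneg J h0)
  tracial x hx := by
    simp only [tildeTrace, tilde_mul, tilde_star]
    exact (hν.tracial _ hx).symm
  faithful a ha h0 h := by
    have := hν.faithful _ ha (tilde_nonneg J h0) h
    rw [← tilde_tilde J a, this, tilde_zero]
  semifinite a ha h0 hne := by
    obtain ⟨b, hb, h1, h2, h3, h4⟩ := hν.semifinite _ ha (tilde_nonneg J h0) (fun h => hne (by
      rw [← tilde_tilde J a, h, tilde_zero]))
    refine ⟨tilde J b, ?_, tilde_nonneg J h1, ?_, ?_, ?_⟩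
    · rw [mem_transpose, tilde_tilde]; exact hb
    · rw [← tilde_tilde J a]; exact tilde_mono J h2
    · intro h; apply h3; rw [← tilde_tilde J b, h, tilde_zero]
    · rw [tildeTrace, tilde_tilde]; exact h4
  normal := by
    obtain ⟨κ, f, hf⟩ := hν.normal
    refine ⟨κ, fun i => J (f i), fun a ha h0 => ?_⟩
    rw [tildeTrace, hf _ ha (tilde_nonneg J h0)]
    refine tsum_congr fun i => ?_
    rw [tilde_apply, J.inner_right, ContinuousLinearMap.adjoint_inner_left]

theorem sqrt_mem_centralizer {S : Set (H →L[ℂ] H)} {a : H →L[ℂ] H}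
    (ha : a ∈ Set.centralizer S) : CFC.sqrt a ∈ Set.centralizer S := by
  intro m hm
  have h : Commute a m := (ha m hm).symm
  exact (h.cfcₙ_nnreal NNReal.sqrt).symm

theorem sqrt_mem (N : VonNeumannAlgebra H) {a : H →L[ℂ] H} (ha : a ∈ N) : CFC.sqrt a ∈ N := by
  rw [← SetLike.mem_coe, ← N.centralizer_centralizer] at ha ⊢
  exact sqrt_mem_centralizer ha

theorem isIntertwiner_stdRep {N : VonNeumannAlgebra H} {y : H →L[ℂ] H} (hy : y ∈ N) :
    IsIntertwiner N (stdRep N) y := by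
  intro n
  exact VonNeumannAlgebra.mem_commutant_iff.mp n.2 y hy

end TraceTools

/-! ### Traces of squares of operators -/

section Square

variable {H X : Type*} [NormedAddCommGroup H] [InnerProductSpace ℂ H] [CompleteSpace H]
  [NormedAddCommGroup X] [InnerProductSpace ℂ X] [CompleteSpace X]

theorem adjoint_comp_self_nonneg (Q : H →L[ℂ] X) : 0 ≤ Q.adjoint ∘L Q :=
  (ContinuousLinearMap.nonneg_iff_isPositive _).mpr
    (ContinuousLinearMap.isPositive_adjoint_comp_self Q)

theorem norm_eq_of_adjoint_comp_eq {Y : Type*} [NormedAddCommGroup Y] [InnerProductSpace ℂ Y]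
    [CompleteSpace Y] {P : H →L[ℂ] X} {Q : H →L[ℂ] Y}
    (h : P.adjoint ∘L P = Q.adjoint ∘L Q) (x : H) : ‖P x‖ = ‖Q x‖ := by
  have h1 : ⟪P x, P x⟫_ℂ = ⟪Q x, Q x⟫_ℂ := by
    rw [← ContinuousLinearMap.adjoint_inner_right, ← ContinuousLinearMap.adjoint_inner_right]
    exact congrArg (fun T => ⟪x, T x⟫_ℂ) h
  rw [inner_self_eq_norm_sq_to_K, inner_self_eq_norm_sq_to_K] at h1
  have h2 : ‖P x‖ ^ 2 = ‖Q x‖ ^ 2 := by exact_mod_cast h1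
  exact (sq_eq_sq₀ (norm_nonneg _) (norm_nonneg _)).mp h2

theorem eq_zero_of_adjoint_comp_self {T : H →L[ℂ] X} (h : T.adjoint ∘L T = 0) : T = 0 := by
  ext x
  have := norm_eq_of_adjoint_comp_eq (P := T) (Q := (0 : H →L[ℂ] X)) (by rw [h]; simp) x
  simpa using this

theorem adjoint_sqrt (Q : H →L[ℂ] H) : (CFC.sqrt Q).adjoint = CFC.sqrt Q :=
  (CFC.sqrt_nonneg Q).isSelfAdjoint

theorem sqrt_comp_sqrt (Q : H →L[ℂ] X) :
    CFC.sqrt (Q.adjoint ∘L Q) ∘L CFC.sqrt (Q.adjoint ∘L Q) = Q.adjoint ∘L Q :=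
  CFC.sqrt_mul_sqrt_self _ (adjoint_comp_self_nonneg Q)

theorem norm_sqrt_apply (Q : H →L[ℂ] X) (x : H) :
    ‖CFC.sqrt (Q.adjoint ∘L Q) x‖ = ‖Q x‖ := by
  refine norm_eq_of_adjoint_comp_eq ?_ x
  rw [adjoint_sqrt, sqrt_comp_sqrt]

/-- The square root of `Q† Q` has the same square as `Q` and lies in every commutant that contains
`Q† Q`. -/
theorem exists_root_mem_centralizer {S : Set (H →L[ℂ] H)} {Q : H →L[ℂ] X}
    (hQ : Q.adjoint ∘L Q ∈ Set.centralizer S) :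
    ∃ P ∈ Set.centralizer S, P.adjoint ∘L P = Q.adjoint ∘L Q :=
  ⟨CFC.sqrt (Q.adjoint ∘L Q), sqrt_mem_centralizer hQ, by rw [adjoint_sqrt, sqrt_comp_sqrt]⟩

variable {N : VonNeumannAlgebra H} {ν : (H →L[ℂ] H) → ℝ≥0∞}

/-- A family implementing the trace computes `ν(Q† Q)` for operators `Q` into any Hilbert
space. -/
theorem tsum_enorm_eq_trace {κ : Type*} {f : κ → H} (hf : IsTraceFamily N (stdRep N) ν f)
    {Q : H →L[ℂ] X} (hQ : Q.adjoint ∘L Q ∈ N) :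
    ∑' j, ‖Q (f j)‖ₑ ^ 2 = ν (Q.adjoint ∘L Q) := by
  have h := hf _ (isIntertwiner_stdRep (sqrt_mem N hQ))
  rw [adjoint_sqrt, sqrt_comp_sqrt] at h
  rw [← h]
  refine tsum_congr fun j => ?_
  rw [← ofReal_norm, ← ofReal_norm, norm_sqrt_apply]

/-- The bound defining `ν`-bounded vectors extends to operators `Q` into any Hilbert space, with
`ν(Q† Q)` in place of `ν(y y†)`; the hypothesis is applied to `y = (Q† Q)^{1/2}`. -/
theorem enorm_sq_le_trace {f : H} {C : ℝ≥0}
    (hf : ∀ y : H →L[ℂ] H, IsIntertwiner N (stdRep N) y → ‖y f‖ₑ ^ 2 ≤ C * ν (y ∘L y.adjoint))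
    {Q : H →L[ℂ] X} (hQ : Q.adjoint ∘L Q ∈ N) :
    ‖Q f‖ₑ ^ 2 ≤ C * ν (Q.adjoint ∘L Q) := by
  have h := hf _ (isIntertwiner_stdRep (sqrt_mem N hQ))
  rw [adjoint_sqrt, sqrt_comp_sqrt] at h
  rwa [← ofReal_norm, norm_sqrt_apply, ofReal_norm] at h

/-- Traciality in terms of a family implementing the trace. -/
theorem tsum_enorm_adjoint (htr : ∀ x ∈ N, ν (star x * x) = ν (x * star x))
    {κ : Type*} {f : κ → H} (hf : IsTraceFamily N (stdRep N) ν f) {w : H →L[ℂ] H} (hw : w ∈ N) :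
    ∑' j, ‖w.adjoint (f j)‖ₑ ^ 2 = ∑' j, ‖w (f j)‖ₑ ^ 2 := by
  have hw' : w.adjoint ∈ N := star_mem (S := VonNeumannAlgebra H) hw
  rw [hf _ (isIntertwiner_stdRep hw), hf _ (isIntertwiner_stdRep hw'),
    ContinuousLinearMap.adjoint_adjoint]
  exact htr w hw

/-- The square `X† X` commutes with the operators that `X` intertwines. -/
theorem adjoint_comp_self_comm {X' : H →L[ℂ] X} {c : H →L[ℂ] H} {p : X →L[ℂ] X}
    (h : X' ∘L c = p ∘L X') (h' : X' ∘L c.adjoint = p.adjoint ∘L X') :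
    c ∘L (X'.adjoint ∘L X') = (X'.adjoint ∘L X') ∘L c := by
  have h2 := congrArg ContinuousLinearMap.adjoint h'
  rw [ContinuousLinearMap.adjoint_comp, ContinuousLinearMap.adjoint_comp,
    ContinuousLinearMap.adjoint_adjoint, ContinuousLinearMap.adjoint_adjoint] at h2
  rw [ContinuousLinearMap.comp_assoc, h, ← ContinuousLinearMap.comp_assoc, h2,
    ContinuousLinearMap.comp_assoc]

end Square

/-! ### Polarization of sums of squares -/

section Polarize

variable {X Y : Type*} [NormedAddCommGroup X] [InnerProductSpace ℂ X]
  [NormedAddCommGroup Y] [InnerProductSpace ℂ Y] {ι κ : Type*}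

theorem hasSum_norm_sq {x : ι → X} (hx : ∑' i, ‖x i‖ₑ ^ 2 ≠ ∞) :
    HasSum (fun i => ‖x i‖ ^ 2) (∑' i, ‖x i‖ₑ ^ 2).toReal := by
  have h := ENNReal.hasSum_toReal hx
  rw [← ENNReal.tsum_toReal_eq (fun i => ENNReal.ne_top_of_tsum_ne_top hx i)] at h
  simpa using h

theorem tsum_enorm_sq_ne_top {x : ι → X} (hx : Summable fun i => ‖x i‖ ^ 2) :
    ∑' i, ‖x i‖ₑ ^ 2 ≠ ∞ := by
  have := hx.tsum_ofReal_ne_top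
  simpa [ENNReal.ofReal_pow, ofReal_norm] using this

theorem tsum_enorm_sq_add_smul_ne_top {x x' : ι → X} (hx : ∑' i, ‖x i‖ₑ ^ 2 ≠ ∞)
    (hx' : ∑' i, ‖x' i‖ₑ ^ 2 ≠ ∞) (c : ℂ) : ∑' i, ‖x i + c • x' i‖ₑ ^ 2 ≠ ∞ := by
  refine tsum_enorm_sq_ne_top ?_
  have h1 := (hasSum_norm_sq hx).summable
  have h2 := (hasSum_norm_sq hx').summable
  refine Summable.of_nonneg_of_le (fun i => sq_nonneg _) (fun i => ?_)
    ((h1.mul_left 2).add (h2.mul_left (2 * ‖c‖ ^ 2)))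
  have h3 : ‖x i + c • x' i‖ ≤ ‖x i‖ + ‖c‖ * ‖x' i‖ := (norm_add_le _ _).trans (by rw [norm_smul])
  have h4 := norm_nonneg (x i + c • x' i)
  nlinarith [sq_nonneg (‖x i‖ - ‖c‖ * ‖x' i‖)]

/-- Polarization of a sum: the right-hand side is the polarization of the quadratic sums `s`. -/
theorem hasSum_inner_of_polarization {x x' : ι → X} {s : ℂ → ℝ}
    (h : ∀ c : ℂ, HasSum (fun i => ‖x i + c • x' i‖ ^ 2) (s c)) :
    HasSum (fun i => ⟪x i, x' i⟫_ℂ)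
      (((s 1 : ℂ) - s (-1) + (s (-Complex.I) - s Complex.I) * Complex.I) / 4) := by
  have h' : ∀ c : ℂ, HasSum (fun i => ((‖x i + c • x' i‖ ^ 2 : ℝ) : ℂ)) (s c) :=
    fun c => Complex.hasSum_ofReal.mpr (h c)
  have := (((h' 1).sub (h' (-1))).add
    (((h' (-Complex.I)).sub (h' Complex.I)).mul_right Complex.I)).div_const 4
  have e : (fun i => ⟪x i, x' i⟫_ℂ) = fun i => (((‖x i + (1 : ℂ) • x' i‖ ^ 2 : ℝ) : ℂ)
      - ((‖x i + (-1 : ℂ) • x' i‖ ^ 2 : ℝ) : ℂ)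
      + (((‖x i + (-Complex.I) • x' i‖ ^ 2 : ℝ) : ℂ)
      - ((‖x i + Complex.I • x' i‖ ^ 2 : ℝ) : ℂ)) * Complex.I) / 4 := by
    funext i
    rw [inner_eq_sum_norm_sq_div_four (𝕜 := ℂ)]
    simp [sub_eq_add_neg]
  rw [e]
  exact this

/-- Two families of pairs of vectors with the same quadratic sums have the same sesquilinear
sums. -/
theorem hasSum_inner_of_tsum_eq {x x' : ι → X} {y y' : κ → Y}
    (hx : ∑' i, ‖x i‖ₑ ^ 2 ≠ ∞) (hx' : ∑' i, ‖x' i‖ₑ ^ 2 ≠ ∞)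
    (h : ∀ c : ℂ, ∑' i, ‖x i + c • x' i‖ₑ ^ 2 = ∑' k, ‖y k + c • y' k‖ₑ ^ 2) :
    ∃ S, HasSum (fun i => ⟪x i, x' i⟫_ℂ) S ∧ HasSum (fun k => ⟪y k, y' k⟫_ℂ) S := by
  have h1 : ∀ c : ℂ, HasSum (fun i => ‖x i + c • x' i‖ ^ 2)
      (∑' i, ‖x i + c • x' i‖ₑ ^ 2).toReal :=
    fun c => hasSum_norm_sq (tsum_enorm_sq_add_smul_ne_top hx hx' c)
  have h2 : ∀ c : ℂ, HasSum (fun k => ‖y k + c • y' k‖ ^ 2)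
      (∑' i, ‖x i + c • x' i‖ₑ ^ 2).toReal := by
    intro c
    rw [h c]
    refine hasSum_norm_sq ?_
    rw [← h c]
    exact tsum_enorm_sq_add_smul_ne_top hx hx' c
  exact ⟨_, hasSum_inner_of_polarization h1, hasSum_inner_of_polarization h2⟩

/-- The version of `hasSum_inner_of_tsum_eq` for families that depend antilinearly on each
other. -/
theorem hasSum_inner_of_tsum_eq_conj {x x' : ι → X} {y y' : κ → Y}
    (hx : ∑' i, ‖x i‖ₑ ^ 2 ≠ ∞) (hx' : ∑' i, ‖x' i‖ₑ ^ 2 ≠ ∞)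
    (h : ∀ c : ℂ, ∑' i, ‖x i + c • x' i‖ₑ ^ 2 =
      ∑' k, ‖y k + starRingEnd ℂ c • y' k‖ₑ ^ 2) :
    ∃ S, HasSum (fun i => ⟪x i, x' i⟫_ℂ) S ∧ HasSum (fun k => ⟪y' k, y k⟫_ℂ) S := by
  have h1 : ∀ c : ℂ, HasSum (fun i => ‖x i + c • x' i‖ ^ 2)
      (∑' i, ‖x i + c • x' i‖ₑ ^ 2).toReal :=
    fun c => hasSum_norm_sq (tsum_enorm_sq_add_smul_ne_top hx hx' c)
  have h2 : ∀ c : ℂ, HasSum (fun k => ‖y k + c • y' k‖ ^ 2)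
      (∑' i, ‖x i + starRingEnd ℂ c • x' i‖ₑ ^ 2).toReal := by
    intro c
    have h3 := h (starRingEnd ℂ c)
    rw [Complex.conj_conj] at h3
    rw [h3]
    refine hasSum_norm_sq ?_
    rw [← h3]
    exact tsum_enorm_sq_add_smul_ne_top hx hx' _
  refine ⟨_, hasSum_inner_of_polarization h1, ?_⟩
  have h4 := (hasSum_inner_of_polarization h2).star
  simp only [RCLike.star_def, inner_conj_symm] at h4
  convert h4 using 1
  simp only [map_div₀, map_add, map_sub, map_mul, map_neg, map_one, Complex.conj_I,
    Complex.conj_ofReal, neg_neg, map_ofNat]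
  ring

theorem summable_inner_of_tsum_ne_top {x x' : ι → X} (hx : ∑' i, ‖x i‖ₑ ^ 2 ≠ ∞)
    (hx' : ∑' i, ‖x' i‖ₑ ^ 2 ≠ ∞) : Summable fun i => ⟪x i, x' i⟫_ℂ := by
  obtain ⟨S, hS, -⟩ := hasSum_inner_of_tsum_eq hx hx' fun c => rfl
  exact hS.summable

end Polarize

/-! ### Trace-bounded vectors -/

section Bounded

variable {H F : Type*} [NormedAddCommGroup H] [InnerProductSpace ℂ H] [CompleteSpace H]
  [NormedAddCommGroup F] [InnerProductSpace ℂ F] [CompleteSpace F]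
  {N : VonNeumannAlgebra H} {π : N.commutant.toStarSubalgebra →⋆ₐ[ℂ] (F →L[ℂ] F)}
  {ν : (H →L[ℂ] H) → ℝ≥0∞}

theorem enorm_add_sq_le {X : Type*} [NormedAddCommGroup X] (x y : X) :
    ‖x + y‖ₑ ^ 2 ≤ 2 * ‖x‖ₑ ^ 2 + 2 * ‖y‖ₑ ^ 2 := by
  simp only [← ofReal_norm]
  rw [← ENNReal.ofReal_pow (norm_nonneg _), ← ENNReal.ofReal_pow (norm_nonneg _),
    ← ENNReal.ofReal_pow (norm_nonneg _),
    show (2 : ℝ≥0∞) = ENNReal.ofReal 2 by simp,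
    ← ENNReal.ofReal_mul (by norm_num), ← ENNReal.ofReal_mul (by norm_num),
    ← ENNReal.ofReal_add (by positivity) (by positivity)]
  refine ENNReal.ofReal_le_ofReal ?_
  nlinarith [norm_add_le x y, norm_nonneg (x + y), sq_nonneg (‖x‖ - ‖y‖)]

theorem enorm_apply_sq_le {X Y : Type*} [NormedAddCommGroup X] [NormedSpace ℂ X]
    [NormedAddCommGroup Y] [NormedSpace ℂ Y] (T : X →L[ℂ] Y) (x : X) :
    ‖T x‖ₑ ^ 2 ≤ ‖T‖ₑ ^ 2 * ‖x‖ₑ ^ 2 := by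
  rw [← mul_pow]
  gcongr
  exact T.le_opENorm x

/-- The subspace of the `ν`-bounded vectors. -/
def boundedVectors (N : VonNeumannAlgebra H)
    (π : N.commutant.toStarSubalgebra →⋆ₐ[ℂ] (F →L[ℂ] F)) (ν : (H →L[ℂ] H) → ℝ≥0∞) :
    Submodule ℂ F where
  carrier := {f | IsTraceBounded N π ν f}
  zero_mem' := ⟨0, fun y _ => by simp⟩
  add_mem' := by
    rintro f f' ⟨C, hC⟩ ⟨C', hC'⟩
    refine ⟨2 * C + 2 * C', fun y hy => ?_⟩
    rw [map_add]
    refine (enorm_add_sq_le _ _).trans ?_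
    push_cast
    rw [add_mul, mul_assoc, mul_assoc]
    gcongr
    · exact hC y hy
    · exact hC' y hy
  smul_mem' := by
    rintro c f ⟨C, hC⟩
    refine ⟨‖c‖₊ ^ 2 * C, fun y hy => ?_⟩
    rw [map_smul, enorm_smul, mul_pow]
    push_cast
    rw [mul_assoc]
    exact mul_le_mul_right (hC y hy) _

theorem IsTraceFamily.isTraceBounded {κ : Type*} {f : κ → F} (hf : IsTraceFamily N π ν f)
    (j : κ) : IsTraceBounded N π ν (f j) := by
  refine ⟨1, fun y hy => ?_⟩
  rw [ENNReal.coe_one, one_mul, ← hf y hy]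
  exact ENNReal.le_tsum j

theorem IsTraceBounded.rep {f : F} (hf : IsTraceBounded N π ν f)
    (n : N.commutant.toStarSubalgebra) : IsTraceBounded N π ν (π n f) := by
  obtain ⟨C, hC⟩ := hf
  refine ⟨‖(n : H →L[ℂ] H)‖₊ ^ 2 * C, fun y hy => ?_⟩
  have h : y (π n f) = (n : H →L[ℂ] H) (y f) := congrArg (fun T => T f) (hy n)
  rw [h]
  refine (enorm_apply_sq_le _ _).trans ?_
  push_cast
  rw [mul_assoc]
  exact mul_le_mul_right (hC y hy) _

theorem IsIntertwiner.comp_adjoint_mem {y : F →L[ℂ] H} (hy : IsIntertwiner N π y) :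
    y ∘L y.adjoint ∈ N := by
  rw [← N.commutant_commutant, VonNeumannAlgebra.mem_commutant_iff]
  intro n hn
  have h1 := hy ⟨n, hn⟩
  have h2 := congrArg ContinuousLinearMap.adjoint (hy (star ⟨n, hn⟩))
  have h3 : (π (star ⟨n, hn⟩)).adjoint = π ⟨n, hn⟩ := by
    rw [map_star]; exact star_star _
  rw [ContinuousLinearMap.adjoint_comp, ContinuousLinearMap.adjoint_comp, h3] at h2
  have h4 : ((star (⟨n, hn⟩ : N.commutant.toStarSubalgebra) :
      N.commutant.toStarSubalgebra) : H →L[ℂ] H).adjoint = n := star_star n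
  rw [h4] at h2
  change n ∘L (y ∘L y.adjoint) = (y ∘L y.adjoint) ∘L n
  rw [ContinuousLinearMap.comp_assoc, ← h2, ← ContinuousLinearMap.comp_assoc,
    ← ContinuousLinearMap.comp_assoc, h1]

theorem orthogonal_invariant {S : Submodule ℂ F} (hS : ∀ n, ∀ x ∈ S, π n x ∈ S) :
    ∀ n, ∀ x ∈ Sᗮ, π n x ∈ Sᗮ := by
  intro n x hx
  rw [Submodule.mem_orthogonal] at hx ⊢
  intro u hu
  rw [← ContinuousLinearMap.adjoint_inner_left]
  have : (π n).adjoint = π (star n) := (map_star π n).symm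
  rw [this]
  exact hx _ (hS _ _ hu)

/-- The `ν`-bounded vectors of an auxiliary space are dense. A vector orthogonal to them is
annihilated by every intertwiner, because the trace is faithful, and such a vector is itself
bounded. -/
theorem dense_boundedVectors (hfaith : ∀ a ∈ N, 0 ≤ a → ν a = 0 → a = 0)
    {κ : Type*} {f : κ → F} (hf : IsTraceFamily N π ν f) :
    (boundedVectors N π ν).topologicalClosure = ⊤ := by
  rw [Submodule.topologicalClosure_eq_top_iff, eq_bot_iff]
  intro v hv
  set U : Submodule ℂ F := (boundedVectors N π ν)ᗮ with hU
  have hUinv : ∀ n, ∀ x ∈ U, π n x ∈ U :=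
    orthogonal_invariant fun n x hx => IsTraceBounded.rep hx n
  have hUinv' : ∀ n, ∀ x ∈ Uᗮ, π n x ∈ Uᗮ := orthogonal_invariant hUinv
  have hcomm : ∀ n, U.starProjection ∘L π n = π n ∘L U.starProjection := by
    intro n
    ext x
    change U.starProjection (π n x) = π n (U.starProjection x)
    refine (Submodule.eq_starProjection_of_mem_orthogonal
      (hUinv n _ (Submodule.starProjection_apply_mem U x)) ?_)
    rw [← map_sub]
    exact hUinv' n _ (Submodule.sub_starProjection_mem_orthogonal x)
  have hzero : ∀ y : F →L[ℂ] H, IsIntertwiner N π y → y v = 0 := by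
    intro y hy
    have hyq : IsIntertwiner N π (y ∘L U.starProjection) := by
      intro n
      rw [ContinuousLinearMap.comp_assoc, hcomm, ← ContinuousLinearMap.comp_assoc, hy n,
        ContinuousLinearMap.comp_assoc]
    have h1 := hf _ hyq
    have h2 : ∀ j, U.starProjection (f j) = 0 := by
      intro j
      rw [Submodule.starProjection_apply_eq_zero_iff, hU]
      exact Submodule.le_orthogonal_orthogonal _ (hf.isTraceBounded j)
    have h3 : ν ((y ∘L U.starProjection) ∘L (y ∘L U.starProjection).adjoint) = 0 := by
      rw [← h1]
      simp [h2]
    have h4 := hfaith _ hyq.comp_adjoint_mem (by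
      have := adjoint_comp_self_nonneg (y ∘L U.starProjection).adjoint
      rwa [ContinuousLinearMap.adjoint_adjoint] at this) h3
    have h5 : (y ∘L U.starProjection).adjoint = 0 := by
      refine eq_zero_of_adjoint_comp_self ?_
      rwa [ContinuousLinearMap.adjoint_adjoint]
    have h6 : y ∘L U.starProjection = 0 := by
      rw [← ContinuousLinearMap.adjoint_adjoint (y ∘L U.starProjection), h5, map_zero]
    have h7 := congrArg (fun T => T v) h6
    simpa [Submodule.starProjection_eq_self_iff.mpr hv] using h7
  have hb : v ∈ boundedVectors N π ν := ⟨0, fun y hy => by simp [hzero y hy]⟩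
  rw [Submodule.mem_bot, ← inner_self_eq_zero (𝕜 := ℂ)]
  exact (Submodule.mem_orthogonal _ _).mp hv v hb

/-- Traciality makes the trace-bounded vectors of the standard representation invariant under the
algebra itself: `ν(y a a† y†) ≤ ‖a†‖² ν(y y†)`. -/
theorem IsTraceBounded.apply_mem (hν : ∀ x ∈ N, ν (star x * x) = ν (x * star x))
    {κ : Type*} {h : κ → H} (hh : IsTraceFamily N (stdRep N) ν h)
    {g : H} (hg : IsTraceBounded N (stdRep N) ν g) {a : H →L[ℂ] H} (ha : a ∈ N) :
    IsTraceBounded N (stdRep N) ν (a g) := by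
  obtain ⟨C, hC⟩ := hg
  refine ⟨C * ‖a.adjoint‖₊ ^ 2, fun y hy => ?_⟩
  have hyN := mem_of_isIntertwiner_stdRep N y hy
  have hya : y ∘L a ∈ N := mul_mem hyN ha
  refine (hC (y ∘L a) (isIntertwiner_stdRep hya)).trans ?_
  push_cast
  rw [mul_assoc]
  refine mul_le_mul_right ?_ _
  rw [← hh _ hy, ← hh _ (isIntertwiner_stdRep hya), ← tsum_enorm_adjoint hν hh hya,
    ← tsum_enorm_adjoint hν hh hyN, ← ENNReal.tsum_mul_left]
  refine ENNReal.tsum_le_tsum fun j => ?_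
  rw [ContinuousLinearMap.adjoint_comp]
  exact enorm_apply_sq_le _ _

end Bounded

/-! ### Partial transposition -/

section Core

variable {H F E : Type*} [NormedAddCommGroup H] [InnerProductSpace ℂ H] [CompleteSpace H]
  [NormedAddCommGroup F] [InnerProductSpace ℂ F] [CompleteSpace F]
  [NormedAddCommGroup E] [InnerProductSpace ℂ E] [CompleteSpace E]
  (JH : Conjugation H) (JF : Conjugation F)
  {B : VonNeumannAlgebra H} (π : B.commutant.toStarSubalgebra →⋆ₐ[ℂ] (F →L[ℂ] F))
  {ν : (H →L[ℂ] H) → ℝ≥0∞}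

/-- `X : H → E ⊗ F` intertwines, up to the conjugations, the actions of `B'` on `H` and on the
second factor `F`. -/
def IsConjIntertwiner (X : H →L[ℂ] HT E F) : Prop :=
  ∀ n : B.commutant.toStarSubalgebra,
    X ∘L conjOp JH JH n = opT (ContinuousLinearMap.id ℂ E) (conjOp JF JF (π n)) ∘L X

/-- The vector `Φ` of `E ⊗ H` is the partial transpose of `X : H → E ⊗ F` at `f ∈ F`:
`(ξ ⊗ η)† Φ = (ξ ⊗ Jf)† X (Jη)`. For `X = ϰ'(ζ ⊗ ·)` this is the relation between `Φ = ϰ(ζ ⊗ f)`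
and the amplitude `ϰ'`. -/
def IsTransposeAt (X : H →L[ℂ] HT E F) (f : F) (Φ : HT E H) : Prop :=
  ∀ ξ η, ⟪tp ξ η, Φ⟫_ℂ = ⟪tp ξ (JF f), X (JH η)⟫_ℂ

variable {JH JF π}

theorem adjoint_conjOp_rep (n : B.commutant.toStarSubalgebra) :
    (conjOp JF JF (π n)).adjoint = conjOp JF JF (π (star n)) := by
  rw [adjoint_conjOp, map_star]; rfl

theorem adjoint_conjOp_coe (n : B.commutant.toStarSubalgebra) :
    (conjOp JH JH (n : H →L[ℂ] H)).adjoint =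
      conjOp JH JH ((star n : B.commutant.toStarSubalgebra) : H →L[ℂ] H) := by
  rw [adjoint_conjOp]; rfl

theorem IsConjIntertwiner.add_smul {X X' : H →L[ℂ] HT E F} (hX : IsConjIntertwiner JH JF π X)
    (hX' : IsConjIntertwiner JH JF π X') (c : ℂ) : IsConjIntertwiner JH JF π (X + c • X') := by
  intro n
  rw [ContinuousLinearMap.add_comp, ContinuousLinearMap.comp_add, ContinuousLinearMap.smul_comp,
    ContinuousLinearMap.comp_smul, hX n, hX' n]

theorem IsConjIntertwiner.comp_tilde {X : H →L[ℂ] HT E F} (hX : IsConjIntertwiner JH JF π X)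
    {b : H →L[ℂ] H} (hb : b ∈ B) : IsConjIntertwiner JH JF π (X ∘L tilde JH b) := by
  intro n
  have h : b.adjoint ∘L (n : H →L[ℂ] H) = (n : H →L[ℂ] H) ∘L b.adjoint :=
    VonNeumannAlgebra.mem_commutant_iff.mp n.2 _ (star_mem (S := VonNeumannAlgebra H) hb)
  rw [ContinuousLinearMap.comp_assoc, tilde_eq_conjOp, ← conjOp_comp, h, conjOp_comp JH JH JH,
    ← ContinuousLinearMap.comp_assoc, hX n, ContinuousLinearMap.comp_assoc]

theorem IsConjIntertwiner.slice {X : H →L[ℂ] HT E F} (hX : IsConjIntertwiner JH JF π X) (e : E)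
    (n : B.commutant.toStarSubalgebra) :
    ((insL e).adjoint ∘L X) ∘L conjOp JH JH n =
      conjOp JF JF (π n) ∘L ((insL e).adjoint ∘L X) := by
  rw [ContinuousLinearMap.comp_assoc, hX n, ← ContinuousLinearMap.comp_assoc, adjoint_insL_opT,
    ContinuousLinearMap.comp_assoc]

section Slice

variable {k : H →L[ℂ] F}
  (hk : ∀ n : B.commutant.toStarSubalgebra, k ∘L conjOp JH JH n = conjOp JF JF (π n) ∘L k)
include hk

theorem adjoint_comp_self_mem_transpose : k.adjoint ∘L k ∈ transpose JH B := by
  refine mem_transpose_of_comm JH B fun n hn => ?_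
  refine adjoint_comp_self_comm (hk ⟨n, hn⟩) ?_
  have := hk (star ⟨n, hn⟩)
  rwa [← adjoint_conjOp_rep, ← adjoint_conjOp_coe] at this

/-- If `k : H → F` intertwines up to the conjugations, then `J k† J : F → H` intertwines the actions
of `B'`. -/
theorem isIntertwiner_conjOp_adjoint : IsIntertwiner B π (conjOp JF JH k.adjoint) := by
  intro n
  have h := congrArg ContinuousLinearMap.adjoint (hk (star n))
  rw [← adjoint_conjOp_rep, ← adjoint_conjOp_coe, ContinuousLinearMap.adjoint_comp,
    ContinuousLinearMap.adjoint_comp, ContinuousLinearMap.adjoint_adjoint,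
    ContinuousLinearMap.adjoint_adjoint] at h
  have h2 := congrArg (conjOp JF JH) h
  rw [conjOp_comp JF JH JH, conjOp_comp JF JF JH, conjOp_conjOp, conjOp_conjOp] at h2
  exact h2.symm

end Slice

/-- `ν(y y†) = ν̃(k† k)` for `y = J k† J`. -/
theorem trace_conjOp_adjoint (k : H →L[ℂ] F) :
    ν (conjOp JF JH k.adjoint ∘L (conjOp JF JH k.adjoint).adjoint) =
      tildeTrace JH ν (k.adjoint ∘L k) := by
  rw [tildeTrace, tilde_eq_conjOp, ContinuousLinearMap.adjoint_comp,
    ContinuousLinearMap.adjoint_adjoint, adjoint_conjOp, ContinuousLinearMap.adjoint_adjoint,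
    conjOp_comp JH JF JH]

theorem IsTransposeAt.slice {X : H →L[ℂ] HT E F} {f : F} {Φ : HT E H}
    (h : IsTransposeAt JH JF X f Φ) (e : E) :
    (insL e).adjoint Φ = conjOp JF JH ((insL e).adjoint ∘L X).adjoint f := by
  refine ext_inner_left ℂ fun η => ?_
  rw [ContinuousLinearMap.adjoint_inner_right, insL_apply, h, conjOp_apply, JH.inner_right,
    ContinuousLinearMap.adjoint_inner_left, ContinuousLinearMap.comp_apply,
    ContinuousLinearMap.adjoint_inner_right, insL_apply]

theorem IsTransposeAt.add_smul {X X' : H →L[ℂ] HT E F} {f : F} {Φ Φ' : HT E H}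
    (h : IsTransposeAt JH JF X f Φ) (h' : IsTransposeAt JH JF X' f Φ') (c : ℂ) :
    IsTransposeAt JH JF (X + c • X') f (Φ + c • Φ') := by
  intro ξ η
  rw [inner_add_right, inner_smul_right, h, h', add_apply, smul_apply, inner_add_right, inner_smul_right]

theorem IsTransposeAt.opT {X : H →L[ℂ] HT E F} {f : F} {Φ : HT E H}
    (h : IsTransposeAt JH JF X f Φ) (b : H →L[ℂ] H) :
    IsTransposeAt JH JF (X ∘L tilde JH b) f (opT (ContinuousLinearMap.id ℂ E) b Φ) := by
  intro ξ η
  rw [← ContinuousLinearMap.adjoint_inner_left, opT_adjoint, opT_tp,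
    ContinuousLinearMap.adjoint_id, ContinuousLinearMap.id_apply, h,
    ContinuousLinearMap.comp_apply, tilde_apply, JH.invol]

theorem IsTransposeAt.unique {X : H →L[ℂ] HT E F} {f : F} {Φ Φ' : HT E H}
    (h : IsTransposeAt JH JF X f Φ) (h' : IsTransposeAt JH JF X f Φ') : Φ = Φ' :=
  ext_inner_tp fun ξ η => by rw [h, h']

/-- The partial transpose preserves the sum of squares over families implementing the trace: on
each slice `k : H → F` of `X` this is `ν(y y†) = ν̃(k† k)` for `y = J k† J`. -/
theorem tsum_enorm_transpose {ι κ : Type*} {f : ι → F} (hf : IsTraceFamily B π ν f) {h : κ → H}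
    (hh : IsTraceFamily (transpose JH B) (stdRep (transpose JH B)) (tildeTrace JH ν) h)
    {X : H →L[ℂ] HT E F} (hX : IsConjIntertwiner JH JF π X) {Φ : ι → HT E H}
    (hΦ : ∀ j, IsTransposeAt JH JF X (f j) (Φ j)) :
    ∑' j, ‖Φ j‖ₑ ^ 2 = ∑' l, ‖X (h l)‖ₑ ^ 2 := by
  obtain ⟨w, e, -⟩ := exists_hilbertBasis ℂ E
  simp_rw [← tsum_enorm_slice e]
  rw [ENNReal.tsum_comm, ENNReal.tsum_comm (f := fun l k => ‖(insL (e k)).adjoint (X (h l))‖ₑ ^ 2)]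
  refine tsum_congr fun k => ?_
  have hk := hX.slice (e k)
  have h1 := tsum_enorm_eq_trace hh (adjoint_comp_self_mem_transpose hk)
  have h2 := hf _ (isIntertwiner_conjOp_adjoint hk)
  rw [trace_conjOp_adjoint (ν := ν), ← h1] at h2
  simp_rw [(hΦ _).slice (e k)]
  exact h2

/-- At `ν`-bounded vectors `f` the partial transpose of `X` exists if `∑ₗ ‖X hₗ‖²` is finite: its
prospective slices `J k† J f` are square summable, by the bound defining `ν`-bounded vectors and
`ν(y y†) = ν̃(k† k)`. -/
theorem exists_isTransposeAt {κ : Type*} {h : κ → H}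
    (hh : IsTraceFamily (transpose JH B) (stdRep (transpose JH B)) (tildeTrace JH ν) h)
    {X : H →L[ℂ] HT E F} (hX : IsConjIntertwiner JH JF π X)
    (hfin : ∑' l, ‖X (h l)‖ₑ ^ 2 ≠ ∞) {f : F} (hf : IsTraceBounded B π ν f) :
    ∃ Φ, IsTransposeAt JH JF X f Φ := by
  obtain ⟨w, e, -⟩ := exists_hilbertBasis ℂ E
  obtain ⟨C, hC⟩ := hf
  have hle : ∑' k, ‖conjOp JF JH ((insL (e k)).adjoint ∘L X).adjoint f‖ₑ ^ 2 ≤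
      C * ∑' l, ‖X (h l)‖ₑ ^ 2 := by
    simp_rw [← tsum_enorm_slice e]
    rw [ENNReal.tsum_comm, ← ENNReal.tsum_mul_left]
    refine ENNReal.tsum_le_tsum fun k => ?_
    have hk := hX.slice (e k)
    have h1 := tsum_enorm_eq_trace hh (adjoint_comp_self_mem_transpose hk)
    refine (hC _ (isIntertwiner_conjOp_adjoint hk)).trans ?_
    rw [trace_conjOp_adjoint (ν := ν), ← h1]
    rfl
  obtain ⟨Φ, hΦ⟩ := exists_slice_eq e _
    (ne_top_of_le_ne_top (ENNReal.mul_ne_top ENNReal.coe_ne_top hfin) hle)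
  refine ⟨Φ, fun ξ η => ?_⟩
  -- the slices of `Φ` are only known along the basis `e`, so `ξ` is expanded in that basis
  have key : (insR η).adjoint Φ = (insR (JF f)).adjoint (X (JH η)) := by
    refine e.repr.injective ?_
    ext k
    rw [e.repr_apply_apply, e.repr_apply_apply, ContinuousLinearMap.adjoint_inner_right,
      ContinuousLinearMap.adjoint_inner_right, insR_apply, insR_apply]
    have h1 := congrArg (fun v => ⟪η, v⟫_ℂ) (hΦ k)
    rw [ContinuousLinearMap.adjoint_inner_right, insL_apply, conjOp_apply, JH.inner_right,
      ContinuousLinearMap.adjoint_inner_left, ContinuousLinearMap.comp_apply,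
      ContinuousLinearMap.adjoint_inner_right, insL_apply] at h1
    exact h1
  have h2 := congrArg (fun v => ⟪ξ, v⟫_ℂ) key
  rwa [ContinuousLinearMap.adjoint_inner_right, ContinuousLinearMap.adjoint_inner_right,
    insR_apply, insR_apply] at h2

/-- The partial trace over `F` of the partial transposes is a partial trace over `H` of the
original operators. -/
theorem exists_hasSum_transpose {ι κ : Type*} {f : ι → F} (hf : IsTraceFamily B π ν f) {h : κ → H}
    (hh : IsTraceFamily (transpose JH B) (stdRep (transpose JH B)) (tildeTrace JH ν) h)
    {X X' : H →L[ℂ] HT E F} (hX : IsConjIntertwiner JH JF π X)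
    (hX' : IsConjIntertwiner JH JF π X') {Φ Φ' : ι → HT E H}
    (hΦ : ∀ j, IsTransposeAt JH JF X (f j) (Φ j))
    (hΦ' : ∀ j, IsTransposeAt JH JF X' (f j) (Φ' j))
    (hfin : ∑' j, ‖Φ j‖ₑ ^ 2 ≠ ∞) (hfin' : ∑' j, ‖Φ' j‖ₑ ^ 2 ≠ ∞)
    {b : H →L[ℂ] H} (hb : b ∈ B) :
    ∃ S, HasSum (fun j => ⟪Φ' j, opT (ContinuousLinearMap.id ℂ E) b (Φ j)⟫_ℂ) S ∧
      HasSum (fun l => ⟪X' (h l), X (tilde JH b (h l))⟫_ℂ) S := by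
  refine hasSum_inner_of_tsum_eq hfin' ?_ fun c => ?_
  · refine ne_top_of_le_ne_top (ENNReal.mul_ne_top (a := ‖opT (ContinuousLinearMap.id ℂ E) b‖ₑ ^ 2)
      (by simp) hfin) ?_
    rw [← ENNReal.tsum_mul_left]
    exact ENNReal.tsum_le_tsum fun j => enorm_apply_sq_le _ _
  · exact tsum_enorm_transpose hf hh (hX'.add_smul (hX.comp_tilde hb) c)
      fun j => (hΦ' j).add_smul ((hΦ j).opT b) c

end Core

/-! ### Sesquilinear forms on dense subspaces -/

section Form

variable {G : Type*} [NormedAddCommGroup G] [InnerProductSpace ℂ G] [CompleteSpace G]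

theorem eq_of_inner_eq_of_dense {V : Submodule ℂ G} (hV : V.topologicalClosure = ⊤) {x y : G}
    (h : ∀ v ∈ V, ⟪v, x⟫_ℂ = ⟪v, y⟫_ℂ) : x = y := by
  have hx : x - y ∈ Vᗮ := by
    rw [Submodule.mem_orthogonal]
    intro v hv
    rw [inner_sub_right, h v hv, sub_self]
  rw [Submodule.topologicalClosure_eq_top_iff.mp hV, Submodule.mem_bot] at hx
  exact sub_eq_zero.mp hx

theorem eq_zero_of_inner_of_dense {s : Set G} (hs : (Submodule.span ℂ s).topologicalClosure = ⊤)
    {y : G} (h : ∀ x ∈ s, ⟪x, y⟫_ℂ = 0) : y = 0 := by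
  refine eq_of_inner_eq_of_dense hs fun v hv => ?_
  rw [inner_zero_right]
  have h1 : Submodule.span ℂ s ≤ (ℂ ∙ y)ᗮ := by
    rw [Submodule.span_le]
    intro x hx
    exact Submodule.mem_orthogonal_singleton_iff_inner_left.mpr (h x hx)
  exact Submodule.mem_orthogonal_singleton_iff_inner_left.mp (h1 hv)

/-- A bounded sesquilinear form on a dense subspace is given by a bounded operator. -/
theorem exists_operator_of_form {V : Submodule ℂ G} (hV : V.topologicalClosure = ⊤)
    {R : G → G → ℂ}
    (add_left : ∀ x ∈ V, ∀ x' ∈ V, ∀ y ∈ V, R (x + x') y = R x y + R x' y)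
    (smul_left : ∀ c : ℂ, ∀ x ∈ V, ∀ y ∈ V, R (c • x) y = starRingEnd ℂ c * R x y)
    (add_right : ∀ x ∈ V, ∀ y ∈ V, ∀ y' ∈ V, R x (y + y') = R x y + R x y')
    (smul_right : ∀ c : ℂ, ∀ x ∈ V, ∀ y ∈ V, R x (c • y) = c * R x y)
    {C : ℝ} (bound : ∀ x ∈ V, ∀ y ∈ V, ‖R x y‖ ≤ C * ‖x‖ * ‖y‖) :
    ∃ r : G →L[ℂ] G, ∀ x ∈ V, ∀ y ∈ V, R x y = ⟪x, r y⟫_ℂ := by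
  have hbound : ∀ x ∈ V, ∀ y ∈ V, ‖R x y‖ ≤ |C| * ‖y‖ * ‖x‖ := by
    intro x hx y hy
    refine (bound x hx y hy).trans ?_
    rw [mul_right_comm]
    gcongr
    exact le_abs_self C
  have h1 : ∀ y : V, ∃ v : G, ‖v‖ ≤ |C| * ‖(y : G)‖ ∧ ∀ x ∈ V, R x y = ⟪x, v⟫_ℂ := by
    intro y
    let φ : V →ₗ[ℂ] ℂ :=
      { toFun := fun x => starRingEnd ℂ (R x y)
        map_add' := fun x x' => by
          rw [← map_add, ← add_left x x.2 x' x'.2 y y.2]; rfl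
        map_smul' := fun c x => by
          rw [Submodule.coe_smul, smul_left c x x.2 y y.2]; simp }
    let ψ : StrongDual ℂ V := φ.mkContinuous (|C| * ‖(y : G)‖) (fun x => by
      change ‖starRingEnd ℂ (R x y)‖ ≤ _
      rw [RCLike.norm_conj]
      exact hbound x x.2 y y.2)
    obtain ⟨θ, hθ, hn⟩ := exists_extension_norm_eq V ψ
    refine ⟨(InnerProductSpace.toDual ℂ G).symm θ, ?_, fun x hx => ?_⟩
    · rw [LinearIsometryEquiv.norm_map, hn]
      exact LinearMap.mkContinuous_norm_le _ (by positivity) _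
    · rw [← inner_conj_symm, InnerProductSpace.toDual_symm_apply]
      have := hθ ⟨x, hx⟩
      rw [this]
      change _ = starRingEnd ℂ (starRingEnd ℂ (R x y))
      rw [Complex.conj_conj]
  choose v hv hR using h1
  let S : V →ₗ[ℂ] G :=
    { toFun := v
      map_add' := fun y y' => eq_of_inner_eq_of_dense hV fun x hx => by
        rw [inner_add_right, ← hR _ x hx, ← hR _ x hx, ← hR _ x hx]
        exact add_right x hx y y.2 y' y'.2
      map_smul' := fun c y => eq_of_inner_eq_of_dense hV fun x hx => by
        rw [RingHom.id_apply, inner_smul_right, ← hR _ x hx, ← hR _ x hx]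
        exact smul_right c x hx y y.2 }
  have hd : DenseRange V.subtype := by
    rw [DenseRange, Submodule.coe_subtype, Subtype.range_coe]
    exact Submodule.dense_iff_topologicalClosure_eq_top.mpr hV
  refine ⟨S.extendOfNorm V.subtype, fun x hx y hy => ?_⟩
  have := LinearMap.extendOfNorm_eq (f := S) (e := V.subtype) hd ⟨|C|, fun y => hv y⟩ ⟨y, hy⟩
  rw [show V.subtype ⟨y, hy⟩ = y from rfl] at this
  rw [this]
  exact hR ⟨y, hy⟩ x hx

/-- The operator of a form affiliated with `M` lies in `M`. -/
theorem mem_of_form {M : VonNeumannAlgebra G} {V : Submodule ℂ G} (hV : V.topologicalClosure = ⊤)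
    (hinv : ∀ n ∈ M.commutant, ∀ x ∈ V, n x ∈ V) {R : G → G → ℂ}
    (affiliated : ∀ n ∈ M.commutant, ∀ x ∈ V, ∀ y ∈ V, R (n x) y = R x (star n y))
    {r : G →L[ℂ] G} (hr : ∀ x ∈ V, ∀ y ∈ V, R x y = ⟪x, r y⟫_ℂ) : r ∈ M := by
  rw [← M.commutant_commutant, VonNeumannAlgebra.mem_commutant_iff]
  intro n hn
  have hn' : star n ∈ M.commutant := star_mem (S := VonNeumannAlgebra G) hn
  refine ContinuousLinearMap.ext_on (Submodule.dense_iff_topologicalClosure_eq_top.mpr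
    (show (Submodule.span ℂ (V : Set G)).topologicalClosure = ⊤ by rwa [Submodule.span_eq])) ?_
  intro y hy
  refine eq_of_inner_eq_of_dense hV fun x hx => ?_
  change ⟪x, n (r y)⟫_ℂ = ⟪x, r (n y)⟫_ℂ
  rw [← hr x hx _ (hinv n hn y hy), ← ContinuousLinearMap.adjoint_inner_left]
  have h1 := affiliated (star n) hn' x hx y hy
  rw [star_star] at h1
  rw [← h1, hr _ (hinv _ hn' x hx) y hy]
  rfl

end Form

/-! ### Slices and partial traces of an operator commuting with the commutants -/

section Slices

variable {G H Z : Type*} [NormedAddCommGroup G] [InnerProductSpace ℂ G] [CompleteSpace G]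
  [NormedAddCommGroup H] [InnerProductSpace ℂ H] [CompleteSpace H]
  [NormedAddCommGroup Z] [InnerProductSpace ℂ Z] [CompleteSpace Z]
  {M : VonNeumannAlgebra G} {N : VonNeumannAlgebra H}
  {μ : (G →L[ℂ] G) → ℝ≥0∞} {ν : (H →L[ℂ] H) → ℝ≥0∞}

/-- `T` commutes with all `n ⊗ m` for `n ∈ M'`, `m ∈ N'`. (By the commutation theorem for tensor
products this says `T ∈ M ⊗ N`, which is not needed here.) -/
def CommutesWithCommutants (M : VonNeumannAlgebra G) (N : VonNeumannAlgebra H)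
    (T : HT G H →L[ℂ] HT G H) : Prop :=
  ∀ n ∈ M.commutant, ∀ m ∈ N.commutant, opT n m ∘L T = T ∘L opT n m

theorem commutesWithCommutants_of_mem_vnTensor {T : HT G H →L[ℂ] HT G H}
    (hT : T ∈ vnTensor M N) : CommutesWithCommutants M N T := by
  intro n hn m hm
  refine hT _ ?_
  rintro x ⟨a, ha, b, hb, rfl⟩
  change opT a b ∘L opT n m = opT n m ∘L opT a b
  rw [opT_comp, opT_comp]
  have h1 : a ∘L n = n ∘L a := VonNeumannAlgebra.mem_commutant_iff.mp hn a ha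
  have h2 : b ∘L m = m ∘L b := VonNeumannAlgebra.mem_commutant_iff.mp hm b hb
  rw [h1, h2]

theorem CommutesWithCommutants.sub {S T : HT G H →L[ℂ] HT G H}
    (hS : CommutesWithCommutants M N S) (hT : CommutesWithCommutants M N T) :
    CommutesWithCommutants M N (S - T) := by
  intro n hn m hm
  rw [ContinuousLinearMap.comp_sub, ContinuousLinearMap.sub_comp, hS n hn m hm, hT n hn m hm]

theorem CommutesWithCommutants.left {T : HT G H →L[ℂ] HT G H}
    (hT : CommutesWithCommutants M N T) {n : G →L[ℂ] G} (hn : n ∈ M.commutant) :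
    opT n (ContinuousLinearMap.id ℂ H) ∘L T = T ∘L opT n (ContinuousLinearMap.id ℂ H) :=
  hT n hn _ (one_mem N.commutant)

theorem CommutesWithCommutants.right {T : HT G H →L[ℂ] HT G H}
    (hT : CommutesWithCommutants M N T) {m : H →L[ℂ] H} (hm : m ∈ N.commutant) :
    opT (ContinuousLinearMap.id ℂ G) m ∘L T = T ∘L opT (ContinuousLinearMap.id ℂ G) m :=
  hT _ (one_mem M.commutant) m hm

theorem CommutesWithCommutants.slice_left {T : HT G H →L[ℂ] HT G H}
    (hT : CommutesWithCommutants M N T) (h' h : H) :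
    (insR h').adjoint ∘L T ∘L insR h ∈ M := by
  rw [← M.commutant_commutant, VonNeumannAlgebra.mem_commutant_iff]
  intro n hn
  have hn' : n.adjoint ∈ M.commutant := star_mem (S := VonNeumannAlgebra G) hn
  have h1 := congrArg ContinuousLinearMap.adjoint
    (opT_insR n.adjoint (ContinuousLinearMap.id ℂ H) h')
  rw [ContinuousLinearMap.adjoint_comp, ContinuousLinearMap.adjoint_comp, opT_adjoint,
    ContinuousLinearMap.adjoint_adjoint, ContinuousLinearMap.adjoint_id,
    ContinuousLinearMap.id_apply] at h1
  have h2 := opT_insR n (ContinuousLinearMap.id ℂ H) h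
  rw [ContinuousLinearMap.id_apply] at h2
  change n ∘L ((insR h').adjoint ∘L T ∘L insR h) = ((insR h').adjoint ∘L T ∘L insR h) ∘L n
  rw [← ContinuousLinearMap.comp_assoc, ← h1, ContinuousLinearMap.comp_assoc,
    ← ContinuousLinearMap.comp_assoc _ T, hT.left hn]
  simp only [ContinuousLinearMap.comp_assoc]
  rw [h2]

theorem CommutesWithCommutants.slice_right {T : HT G H →L[ℂ] HT G H}
    (hT : CommutesWithCommutants M N T) (g' g : G) :
    (insL g').adjoint ∘L T ∘L insL g ∈ N := by
  rw [← N.commutant_commutant, VonNeumannAlgebra.mem_commutant_iff]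
  intro m hm
  have h1 := adjoint_insL_opT g' m
  have h2 := opT_insL (ContinuousLinearMap.id ℂ G) m g
  rw [ContinuousLinearMap.id_apply] at h2
  change m ∘L ((insL g').adjoint ∘L T ∘L insL g) = ((insL g').adjoint ∘L T ∘L insL g) ∘L m
  rw [← ContinuousLinearMap.comp_assoc, ← h1, ContinuousLinearMap.comp_assoc,
    ← ContinuousLinearMap.comp_assoc _ T, hT.right hm]
  simp only [ContinuousLinearMap.comp_assoc]
  rw [h2]

variable {K : HT G H →L[ℂ] Z}

theorem adjoint_comp_insR_mem (hK : CommutesWithCommutants M N (K.adjoint ∘L K)) (h : H) :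
    (K ∘L insR h).adjoint ∘L (K ∘L insR h) ∈ M := by
  have := hK.slice_left h h
  rwa [ContinuousLinearMap.adjoint_comp, ContinuousLinearMap.comp_assoc,
    ← ContinuousLinearMap.comp_assoc _ K]

theorem adjoint_comp_insL_mem (hK : CommutesWithCommutants M N (K.adjoint ∘L K)) (g : G) :
    (K ∘L insL g).adjoint ∘L (K ∘L insL g) ∈ N := by
  have := hK.slice_right g g
  rwa [ContinuousLinearMap.adjoint_comp, ContinuousLinearMap.comp_assoc,
    ← ContinuousLinearMap.comp_assoc _ K]

/-- If `K† K` has finite trace, then so do its slices at trace-bounded vectors. -/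
theorem tsum_enorm_slice_ne_top (hK : CommutesWithCommutants M N (K.adjoint ∘L K))
    {ι κ : Type*} {g : ι → G} {h : κ → H} (hg : IsTraceFamily M (stdRep M) μ g)
    (hfin : ∑' (i) (l), ‖K (tp (g i) (h l))‖ₑ ^ 2 ≠ ∞) {ζ : G}
    (hζ : IsTraceBounded M (stdRep M) μ ζ) : ∑' l, ‖K (tp ζ (h l))‖ₑ ^ 2 ≠ ∞ := by
  obtain ⟨C, hC⟩ := hζ
  refine ne_top_of_le_ne_top (ENNReal.mul_ne_top (a := C) ENNReal.coe_ne_top hfin) ?_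
  rw [ENNReal.tsum_comm, ← ENNReal.tsum_mul_left]
  refine ENNReal.tsum_le_tsum fun l => ?_
  have h1 := enorm_sq_le_trace hC (adjoint_comp_insR_mem hK (h l))
  rwa [← tsum_enorm_eq_trace hg (adjoint_comp_insR_mem hK (h l))] at h1

/-- Right multiplication by an element of `N` is bounded in the Hilbert-Schmidt norm of the trace;
this uses traciality, `‖Q t‖₂ = ‖t† w‖₂` for `w = (Q† Q)^{1/2}`. -/
theorem tsum_enorm_comp_le (htr : ∀ x ∈ N, ν (star x * x) = ν (x * star x))
    {κ : Type*} {h : κ → H} (hh : IsTraceFamily N (stdRep N) ν h) {Q : H →L[ℂ] Z}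
    (hQ : Q.adjoint ∘L Q ∈ N) {t : H →L[ℂ] H} (ht : t ∈ N) :
    ∑' l, ‖Q (t (h l))‖ₑ ^ 2 ≤ ‖t.adjoint‖ₑ ^ 2 * ∑' l, ‖Q (h l)‖ₑ ^ 2 := by
  set w := CFC.sqrt (Q.adjoint ∘L Q) with hw
  have hwN : w ∈ N := sqrt_mem N hQ
  have e : ∀ x, ‖Q x‖ₑ = ‖w x‖ₑ := fun x => by
    rw [← ofReal_norm, ← ofReal_norm, hw, norm_sqrt_apply]
  simp_rw [e]
  have h1 := tsum_enorm_adjoint htr hh (w := w ∘L t) (mul_mem hwN ht)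
  rw [ContinuousLinearMap.adjoint_comp, hw, adjoint_sqrt, ← hw] at h1
  refine h1.symm.le.trans ?_
  rw [← ENNReal.tsum_mul_left]
  exact ENNReal.tsum_le_tsum fun l => enorm_apply_sq_le _ _

/-- The form `(g', g) ↦ ∑ₗ ⟨K(g' ⊗ hₗ), K(g ⊗ c hₗ)⟩`, the partial trace of `K† K (1 ⊗ c)`.
The sum converges if `g'` and `g` are trace-bounded and `K† K` has finite trace; elsewhere it may
have the junk value zero. -/
def partialForm {κ : Type*} (K : HT G H →L[ℂ] Z) (h : κ → H) (c : H →L[ℂ] H) (g' g : G) : ℂ :=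
  ∑' l, ⟪K (tp g' (h l)), K (tp g (c (h l)))⟫_ℂ

/-- The partial trace of `K† K (1 ⊗ c)` is a density affiliated with `M`. On the trace-bounded
vectors, which are dense, the sums defining it converge absolutely; where it is bounded it is
therefore given by an operator, which commutes with `M'` because `K† K` does. -/
theorem isDensity_partialForm (hμ : IsNFSTrace M μ) (hν : IsNFSTrace N ν)
    (hK : CommutesWithCommutants M N (K.adjoint ∘L K))
    {ι κ : Type*} {g : ι → G} {h : κ → H} (hg : IsTraceFamily M (stdRep M) μ g)
    (hh : IsTraceFamily N (stdRep N) ν h)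
    (hfin : ∑' (i) (l), ‖K (tp (g i) (h l))‖ₑ ^ 2 ≠ ∞) {c : H →L[ℂ] H} (hc : c ∈ N) :
    IsDensity M μ (partialForm K h c) := by
  have haff : ∀ n ∈ M.commutant, ∀ x y, partialForm K h c (n x) y =
      partialForm K h c x (star n y) := by
    intro n hn x y
    have hn' : n.adjoint ∈ M.commutant := star_mem (S := VonNeumannAlgebra G) hn
    refine tsum_congr fun l => ?_
    have h1 := congrArg (fun T => T (tp y (c (h l)))) (hK.left hn')
    simp only [ContinuousLinearMap.comp_apply, opT_tp, ContinuousLinearMap.id_apply] at h1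
    have h2 := opT_tp n (ContinuousLinearMap.id ℂ H) x (h l)
    rw [ContinuousLinearMap.id_apply] at h2
    rw [← ContinuousLinearMap.adjoint_inner_right, ← ContinuousLinearMap.adjoint_inner_right K,
      ← h2, ← ContinuousLinearMap.adjoint_inner_right (opT n _), opT_adjoint,
      ContinuousLinearMap.adjoint_id, h1]
    rfl
  have hV := dense_boundedVectors (π := stdRep M) hμ.faithful hg
  have hs : ∀ x ∈ boundedVectors M (stdRep M) μ, ∀ y ∈ boundedVectors M (stdRep M) μ,
      Summable fun l => ⟪K (tp x (h l)), K (tp y (c (h l)))⟫_ℂ := by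
    intro x hx y hy
    refine summable_inner_of_tsum_ne_top (tsum_enorm_slice_ne_top hK hg hfin hx) ?_
    exact ne_top_of_le_ne_top
      (ENNReal.mul_ne_top (by simp) (tsum_enorm_slice_ne_top hK hg hfin hy))
      (tsum_enorm_comp_le hν.tracial hh (adjoint_comp_insL_mem hK y) hc)
  refine ⟨fun n hn x y _ _ => haff n hn x y, ?_⟩
  rintro ⟨C, hC⟩
  obtain ⟨r, hr⟩ := exists_operator_of_form hV (R := partialForm K h c) (C := C)
    (fun x hx x' hx' y hy => by
      rw [partialForm, partialForm, partialForm, ← (hs x hx y hy).tsum_add (hs x' hx' y hy)]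
      simp only [tp_add_left, map_add, inner_add_left])
    (fun a x hx y hy => by
      rw [partialForm, partialForm, ← tsum_mul_left]
      simp only [tp_smul_left, map_smul, inner_smul_left])
    (fun x hx y hy y' hy' => by
      rw [partialForm, partialForm, partialForm, ← (hs x hx y hy).tsum_add (hs x hx y' hy')]
      simp only [tp_add_left, map_add, inner_add_right])
    (fun a x hx y hy => by
      rw [partialForm, partialForm, ← tsum_mul_left]
      simp only [tp_smul_left, map_smul, inner_smul_right])
    (fun x hx y hy => hC x y hx hy)
  refine ⟨r, mem_of_form hV (fun n hn x hx => IsTraceBounded.rep hx ⟨n, hn⟩)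
    (fun n hn x _ y _ => haff n hn x y) hr, fun x y hx hy => hr x hx y hy⟩

end Slices

/-! ### Amplitudes -/

section Amplitude

universe u v w z

variable {G : Type u} [NormedAddCommGroup G] [InnerProductSpace ℂ G] [CompleteSpace G]
  {H : Type v} [NormedAddCommGroup H] [InnerProductSpace ℂ H] [CompleteSpace H]
  {E : Type w} [NormedAddCommGroup E] [InnerProductSpace ℂ E] [CompleteSpace E]
  {F : Type z} [NormedAddCommGroup F] [InnerProductSpace ℂ F] [CompleteSpace F]
  {JG : Conjugation G} {JH : Conjugation H} {JE : Conjugation E} {JF : Conjugation F}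
  {A : VonNeumannAlgebra G} {μ : (G →L[ℂ] G) → ℝ≥0∞}
  {B : VonNeumannAlgebra H} {ν : (H →L[ℂ] H) → ℝ≥0∞}
  {auxE : AuxSpace A μ E} {auxF : AuxSpace B ν F} {K : HT G H →L[ℂ] HT E F}

theorem IsAmplitude.comp_conjOp (hK : IsAmplitude JG JH JE JF auxE auxF K)
    (a : A.commutant.toStarSubalgebra) (b : B.commutant.toStarSubalgebra) :
    K ∘L opT (conjOp JG JG a) (conjOp JH JH b) =
      opT (conjOp JE JE (auxE.rep a)) (conjOp JF JF (auxF.rep b)) ∘L K := by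
  ext x
  have h := congrArg (conjT JE JF) (hK a b (conjT JG JH x))
  rw [conjT_conjT, conjT_opT, conjT_opT, conjT_conjT] at h
  exact h

theorem conjOp_rep_one (π : B.commutant.toStarSubalgebra →⋆ₐ[ℂ] (F →L[ℂ] F)) :
    conjOp JF JF (π 1) = ContinuousLinearMap.id ℂ F := by
  rw [map_one]; exact conjOp_one JF

theorem IsAmplitude.isConjIntertwiner (hK : IsAmplitude JG JH JE JF auxE auxF K) (g : G) :
    IsConjIntertwiner JH JF auxF.rep (K ∘L insL g) := by
  intro n
  have h := hK.comp_conjOp 1 n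
  have h1 : conjOp JG JG ((1 : A.commutant.toStarSubalgebra) : G →L[ℂ] G) =
      ContinuousLinearMap.id ℂ G := conjOp_one JG
  rw [conjOp_rep_one, h1] at h
  have h2 := opT_insL (ContinuousLinearMap.id ℂ G) (conjOp JH JH n) g
  rw [ContinuousLinearMap.id_apply] at h2
  rw [ContinuousLinearMap.comp_assoc, ← h2, ← ContinuousLinearMap.comp_assoc, h,
    ContinuousLinearMap.comp_assoc]

/-- The operator with the tensor factors exchanged on both sides. -/
def flipOp (K : HT G H →L[ℂ] HT E F) : HT H G →L[ℂ] HT F E :=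
  flipT E F ∘L K ∘L flipT H G

theorem flipOp_tp (K : HT G H →L[ℂ] HT E F) (h : H) (g : G) :
    flipOp K (tp h g) = flipT E F (K (tp g h)) := by
  simp [flipOp, flipT_tp]

theorem adjoint_flipOp (K : HT G H →L[ℂ] HT E F) : (flipOp K).adjoint = flipOp K.adjoint := by
  rw [flipOp, ContinuousLinearMap.adjoint_comp, ContinuousLinearMap.adjoint_comp, adjoint_flipT,
    adjoint_flipT, ContinuousLinearMap.comp_assoc]
  rfl

theorem adjoint_comp_flipOp (K : HT G H →L[ℂ] HT E F) :
    (flipOp K).adjoint ∘L flipOp K = flipOp (K.adjoint ∘L K) := by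
  rw [adjoint_flipOp]
  ext x
  simp only [flipOp, ContinuousLinearMap.comp_apply, flipT_flipT]

theorem isAmplitude_of_comp_conjOp
    (hK : ∀ (a : A.commutant.toStarSubalgebra) (b : B.commutant.toStarSubalgebra),
      K ∘L opT (conjOp JG JG a) (conjOp JH JH b) =
        opT (conjOp JE JE (auxE.rep a)) (conjOp JF JF (auxF.rep b)) ∘L K) :
    IsAmplitude JG JH JE JF auxE auxF K := by
  intro a b x
  have h1 := conjT_opT JG JH JG JH (a : G →L[ℂ] G) (b : H →L[ℂ] H) (conjT JG JH x)
  have h2 := congrArg (fun T => T (conjT JG JH x)) (hK a b)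
  have h3 := conjT_opT JE JF JE JF (conjOp JE JE (auxE.rep a)) (conjOp JF JF (auxF.rep b))
    (conjT JE JF (K (conjT JG JH x)))
  rw [conjT_conjT] at h1 h3
  rw [conjOp_conjOp, conjOp_conjOp] at h3
  simp only [ContinuousLinearMap.comp_apply] at h2
  rw [h1, h2, h3]

/-- Exchanging the tensor factors turns an amplitude into an amplitude. -/
theorem IsAmplitude.flip (hK : IsAmplitude JG JH JE JF auxE auxF K) :
    IsAmplitude JH JG JF JE auxF auxE (flipOp K) := by
  refine isAmplitude_of_comp_conjOp fun b a => ?_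
  rw [flipOp, ContinuousLinearMap.comp_assoc, ContinuousLinearMap.comp_assoc, flipT_opT,
    ← ContinuousLinearMap.comp_assoc K, hK.comp_conjOp, ContinuousLinearMap.comp_assoc,
    ← ContinuousLinearMap.comp_assoc, flipT_opT, ContinuousLinearMap.comp_assoc]

/-- The square of an amplitude commutes with `n ⊗ m` for `n ∈ Ã'`, `m ∈ B̃'`. -/
theorem IsAmplitude.commutesWithCommutants (hK : IsAmplitude JG JH JE JF auxE auxF K) :
    CommutesWithCommutants (transpose JG A) (transpose JH B) (K.adjoint ∘L K) := by
  intro n hn m hm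
  have ha := conjOp_mem_commutant JG A hn
  have hb := conjOp_mem_commutant JH B hm
  have h := hK.comp_conjOp ⟨_, ha⟩ ⟨_, hb⟩
  have h' := hK.comp_conjOp (star ⟨_, ha⟩) (star ⟨_, hb⟩)
  rw [← adjoint_conjOp_rep, ← adjoint_conjOp_rep, ← adjoint_conjOp_coe, ← adjoint_conjOp_coe,
    ← opT_adjoint, ← opT_adjoint] at h'
  have h1 := adjoint_comp_self_comm h h'
  rwa [conjOp_conjOp, conjOp_conjOp] at h1

/-! ### Partial traces of amplitudes -/

/-- The partial trace over `F` computed from the partial transposes of `K(g ⊗ ·)` is the partial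
trace `∑ₗ ⟨K(g' ⊗ hₗ), K(g ⊗ b̃ hₗ)⟩`. -/
theorem hasSum_partialForm (hK : IsAmplitude JG JH JE JF auxE auxF K)
    {κ : Type*} {h : κ → H}
    (hh : IsTraceFamily (transpose JH B) (stdRep (transpose JH B)) (tildeTrace JH ν) h)
    {ι : Type*} {f : ι → F} (hf : IsTraceFamily B auxF.rep ν f) {g g' : G} {Φ Φ' : ι → HT E H}
    (hΦ : ∀ j, IsTransposeAt JH JF (K ∘L insL g) (f j) (Φ j))
    (hΦ' : ∀ j, IsTransposeAt JH JF (K ∘L insL g') (f j) (Φ' j))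
    (hfin : ∑' l, ‖K (tp g (h l))‖ₑ ^ 2 ≠ ∞) (hfin' : ∑' l, ‖K (tp g' (h l))‖ₑ ^ 2 ≠ ∞)
    {b : H →L[ℂ] H} (hb : b ∈ B) :
    HasSum (fun j => ⟪Φ' j, opT (ContinuousLinearMap.id ℂ E) b (Φ j)⟫_ℂ)
      (partialForm K h (tilde JH b) g' g) := by
  have e := tsum_enorm_transpose hf hh (hK.isConjIntertwiner g) hΦ
  have e' := tsum_enorm_transpose hf hh (hK.isConjIntertwiner g') hΦ'
  obtain ⟨S, h1, h2⟩ := exists_hasSum_transpose hf hh (hK.isConjIntertwiner g)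
    (hK.isConjIntertwiner g') hΦ hΦ' (e ▸ hfin) (e' ▸ hfin') hb
  have h3 : partialForm K h (tilde JH b) g' g = S := h2.tsum_eq
  rwa [h3]

/-- Pairing the partial trace of `K† K (1 ⊗ b̃)` with `a` gives the pairing of `K† K` with `a ⊗ b`. -/
theorem hasPairing_partialForm {a : G →L[ℂ] G} {b : H →L[ℂ] H} {c : ℂ}
    (hc : HasTensorPairing JG JH A μ B ν (K.adjoint ∘L K) a b c) {κ : Type v} {h : κ → H}
    (hh : IsTraceFamily (transpose JH B) (stdRep (transpose JH B)) (tildeTrace JH ν) h) :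
    HasPairing JG A μ (partialForm K h (tilde JH b)) a c := by
  intro ι g hg
  have h1 := hc ι g κ h hg hh
  refine HasSum.prod_fiberwise h1 fun i => ?_
  have h2 : partialForm K h (tilde JH b) (g i) (tilde JG a (g i)) =
      ∑' l, ⟪tp (g i) (h l), (K.adjoint ∘L K) (opT (tilde JG a) (tilde JH b)
        (tp (g i) (h l)))⟫_ℂ := by
    refine tsum_congr fun l => ?_
    rw [ContinuousLinearMap.comp_apply, ContinuousLinearMap.adjoint_inner_right, opT_tp]
  rw [h2]
  exact (h1.summable.prod_factor i).hasSum

theorem HasTensorPairing.flip {D : HT G H →L[ℂ] HT G H} {a : G →L[ℂ] G} {b : H →L[ℂ] H} {c : ℂ}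
    (hc : HasTensorPairing JG JH A μ B ν D a b c) :
    HasTensorPairing JH JG B ν A μ (flipOp D) b a c := by
  intro κ h ι g hh hg
  have h1 := hc ι g κ h hg hh
  rw [← (Equiv.prodComm κ ι).hasSum_iff] at h1
  refine h1.congr_fun fun p => ?_
  simp only [Function.comp_apply, Equiv.prodComm_apply, Prod.fst_swap, Prod.snd_swap, opT_tp,
    flipOp, ContinuousLinearMap.comp_apply, flipT_tp]
  rw [← inner_flipT_flipT, flipT_flipT, flipT_tp]

/-- If the pairing of `K† K` with `1 ⊗ 1` exists, then `K† K` has finite trace. -/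
theorem tsum_enorm_ne_top_of_pairing {Z : Type*} [NormedAddCommGroup Z] [InnerProductSpace ℂ Z]
    [CompleteSpace Z] {K : HT G H →L[ℂ] Z} {c : ℂ}
    (hc : HasTensorPairing JG JH A μ B ν (K.adjoint ∘L K) 1 1 c) {ι : Type u} {g : ι → G}
    {κ : Type v} {h : κ → H}
    (hg : IsTraceFamily (transpose JG A) (stdRep (transpose JG A)) (tildeTrace JG μ) g)
    (hh : IsTraceFamily (transpose JH B) (stdRep (transpose JH B)) (tildeTrace JH ν) h) :
    ∑' (i) (l), ‖K (tp (g i) (h l))‖ₑ ^ 2 ≠ ∞ := by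
  have h1 := (hc ι g κ h hg hh).mapL Complex.reCLM
  rw [← ENNReal.tsum_prod (f := fun i l => ‖K (tp (g i) (h l))‖ₑ ^ 2)]
  refine tsum_enorm_sq_ne_top (x := fun p : ι × κ => K (tp (g p.1) (h p.2))) ?_
  refine h1.summable.congr fun p => ?_
  rw [tilde_one, tilde_one, opT_tp, ContinuousLinearMap.comp_apply,
    ContinuousLinearMap.adjoint_inner_right, one_apply_eq_self, one_apply_eq_self,
    inner_self_eq_norm_sq_to_K]
  simp [← Complex.ofReal_pow]

end Amplitude

/-! ### Partially defined operators on the span of a set -/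

section PMap

variable {X Y : Type*} [NormedAddCommGroup X] [InnerProductSpace ℂ X]
  [NormedAddCommGroup Y] [InnerProductSpace ℂ Y]

/-- An adjointness relation for a partially defined operator needs to be checked only on vectors
spanning the domain. -/
theorem inner_pmap_of_span {T : X →ₗ.[ℂ] Y} {s : Set X} (hs : T.domain = Submodule.span ℂ s)
    {w : X} {y : Y} (h : ∀ x ∈ s, ∀ hx : x ∈ T.domain, ⟪w, x⟫_ℂ = ⟪y, T ⟨x, hx⟩⟫_ℂ)
    (x : T.domain) : ⟪w, (x : X)⟫_ℂ = ⟪y, T x⟫_ℂ := by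
  have h1 : T.domain ≤ Submodule.span ℂ s := hs.le
  have h2 : Submodule.span ℂ s ≤ T.domain := hs.ge
  have key : ∀ x (hx : x ∈ Submodule.span ℂ s), ⟪w, x⟫_ℂ = ⟪y, T ⟨x, h2 hx⟩⟫_ℂ := by
    intro x hx
    induction hx using Submodule.span_induction with
    | mem x hx => exact h x hx _
    | zero =>
      have : (⟨0, h2 (zero_mem _)⟩ : T.domain) = 0 := rfl
      rw [this, T.map_zero, inner_zero_right, inner_zero_right]
    | add x x' hx hx' e e' =>
      have : (⟨x + x', h2 (add_mem hx hx')⟩ : T.domain) = ⟨x, h2 hx⟩ + ⟨x', h2 hx'⟩ := rfl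
      rw [this, T.map_add, inner_add_right, inner_add_right, e, e']
    | smul c x hx e =>
      have : (⟨c • x, h2 (Submodule.smul_mem _ c hx)⟩ : T.domain) = c • ⟨x, h2 hx⟩ := rfl
      rw [this, T.map_smul, inner_smul_right, inner_smul_right, e]
  exact key x (h1 x.2)

theorem pmap_ext_of_span {S T : X →ₗ.[ℂ] Y} {s : Set X} (hS : S.domain = Submodule.span ℂ s)
    (hT : T.domain = Submodule.span ℂ s)
    (h : ∀ x ∈ s, ∀ (hx : x ∈ S.domain) (hx' : x ∈ T.domain), S ⟨x, hx⟩ = T ⟨x, hx'⟩) :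
    S = T := by
  refine LinearPMap.ext (hS.trans hT.symm) fun x hx hx' => ?_
  have key : ∀ x (hx : x ∈ Submodule.span ℂ s), S ⟨x, hS.ge hx⟩ = T ⟨x, hT.ge hx⟩ := by
    intro x hx
    induction hx using Submodule.span_induction with
    | mem x hx => exact h x hx _ _
    | zero => exact S.map_zero.trans T.map_zero.symm
    | add x x' hx hx' e e' =>
      exact (S.map_add ⟨x, hS.ge hx⟩ ⟨x', hS.ge hx'⟩).trans
        ((congrArg₂ (· + ·) e e').trans (T.map_add ⟨x, hT.ge hx⟩ ⟨x', hT.ge hx'⟩).symm)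
    | smul c x hx e =>
      exact (S.map_smul c ⟨x, hS.ge hx⟩).trans
        ((congrArg (c • ·) e).trans (T.map_smul c ⟨x, hT.ge hx⟩).symm)
  exact key x (hS.le hx)

end PMap

/-! ### Entangling operators -/

section Entangling

universe u v w z

variable {G : Type u} [NormedAddCommGroup G] [InnerProductSpace ℂ G] [CompleteSpace G]
  {H : Type v} [NormedAddCommGroup H] [InnerProductSpace ℂ H] [CompleteSpace H]
  {E : Type w} [NormedAddCommGroup E] [InnerProductSpace ℂ E] [CompleteSpace E]
  {F : Type z} [NormedAddCommGroup F] [InnerProductSpace ℂ F] [CompleteSpace F]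
  {JG : Conjugation G} {JH : Conjugation H} {JE : Conjugation E} {JF : Conjugation F}
  {A : VonNeumannAlgebra G} {μ : (G →L[ℂ] G) → ℝ≥0∞}
  {B : VonNeumannAlgebra H} {ν : (H →L[ℂ] H) → ℝ≥0∞}
  {auxE : AuxSpace A μ E} {auxF : AuxSpace B ν F} {K : HT G H →L[ℂ] HT E F}

theorem ev_of_mem {T : HT G F →ₗ.[ℂ] HT E H} {x : HT G F} (hx : x ∈ T.domain) :
    ev T x = T ⟨x, hx⟩ := by
  rw [ev, dif_pos hx]

theorem IsEntangling.tp_mem {ϰ : HT G F →ₗ.[ℂ] HT E H}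
    (hϰ : IsEntangling JG JH JF (A := A) (μ := μ) auxF K ϰ) {g : G} {f : F}
    (hg : IsTraceBounded (transpose JG A) (stdRep (transpose JG A)) (tildeTrace JG μ) g)
    (hf : IsTraceBounded B auxF.rep ν f) : tp g f ∈ ϰ.domain := by
  rw [hϰ.domain_eq]
  exact Submodule.subset_span ⟨g, f, hg, hf, rfl⟩

/-- The relation between an entangling operator and its amplitude `K` says that `ϰ(g ⊗ f)` is the
partial transpose of `K(g ⊗ ·)` at `f`. -/
theorem IsEntangling.isTransposeAt {ϰ : HT G F →ₗ.[ℂ] HT E H}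
    (hϰ : IsEntangling JG JH JF (A := A) (μ := μ) auxF K ϰ) {g : G} {f : F}
    (hx : tp g f ∈ ϰ.domain) : IsTransposeAt JH JF (K ∘L insL g) f (ϰ ⟨tp g f, hx⟩) := by
  intro ξ η
  have h := hϰ.rel ξ (JF f) g η (by rwa [JF.invol])
  simp only [JF.invol] at h
  exact h.symm

theorem IsEntangling.isTransposeAt_ev {ϰ : HT G F →ₗ.[ℂ] HT E H}
    (hϰ : IsEntangling JG JH JF (A := A) (μ := μ) auxF K ϰ) {g : G} {f : F}
    (hg : IsTraceBounded (transpose JG A) (stdRep (transpose JG A)) (tildeTrace JG μ) g)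
    (hf : IsTraceBounded B auxF.rep ν f) :
    IsTransposeAt JH JF (K ∘L insL g) f (ev ϰ (tp g f)) := by
  rw [ev_of_mem (hϰ.tp_mem hg hf)]
  exact hϰ.isTransposeAt _

theorem IsEntangling.unique {ϰ ϰ' : HT G F →ₗ.[ℂ] HT E H}
    (hϰ : IsEntangling JG JH JF (A := A) (μ := μ) auxF K ϰ)
    (hϰ' : IsEntangling JG JH JF (A := A) (μ := μ) auxF K ϰ') : ϰ = ϰ' := by
  refine pmap_ext_of_span hϰ.domain_eq hϰ'.domain_eq ?_
  rintro x ⟨g, f, hg, hf, rfl⟩ hx hx'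
  exact (hϰ.isTransposeAt hx).unique (hϰ'.isTransposeAt hx')

/-- The partial transposes of `K` and of its flipped version are formally adjoint to each other,
up to the conjugations. -/
theorem inner_conjT_flipT {e : E} {h : H} {Ψ : HT F G}
    (hΨ : IsTransposeAt JG JE (flipOp K ∘L insL h) e Ψ) {g : G} {f : F} {Φ : HT E H}
    (hΦ : IsTransposeAt JH JF (K ∘L insL g) f Φ) :
    ⟪conjT JG JF (flipT F G Ψ), tp g f⟫_ℂ = ⟪tp (JE e) (JH h), Φ⟫_ℂ := by
  rw [← inner_conj_symm, inner_conjT, inner_conj_symm, ← inner_flipT_flipT, flipT_flipT,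
    flipT_tp, hΨ, hΦ, JG.invol, JH.invol, ContinuousLinearMap.comp_apply,
    ContinuousLinearMap.comp_apply, insL_apply, insL_apply, flipOp_tp, ← inner_flipT_flipT,
    flipT_flipT, flipT_tp]

/-- The transposed operator `J ϰ† J` is defined at `e ⊗ h` wherever the flipped amplitude has a
partial transpose, and is given by it. -/
theorem IsEntangling.transp_apply {ϰ : HT G F →ₗ.[ℂ] HT E H}
    (hϰ : IsEntangling JG JH JF (A := A) (μ := μ) auxF K ϰ) {e : E} {h : H} {Ψ : HT F G}
    (hΨ : IsTransposeAt JG JE (flipOp K ∘L insL h) e Ψ) :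
    ∃ hx : tp e h ∈ (transp JG JH JE JF ϰ).domain,
      transp JG JH JE JF ϰ ⟨tp e h, hx⟩ = flipT F G Ψ := by
  have key := inner_pmap_of_span hϰ.domain_eq (w := conjT JG JF (flipT F G Ψ))
    (y := conjT JE JH (tp e h)) (by
      rintro x ⟨g, f, -, -, rfl⟩ hx
      rw [conjT_tp]
      exact inner_conjT_flipT hΨ (hϰ.isTransposeAt hx))
  have hmem : conjT JE JH (tp e h) ∈ ϰ.adjoint.domain :=
    LinearPMap.mem_adjoint_domain_of_exists _ ⟨_, key⟩
  refine ⟨hmem, ?_⟩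
  change conjT JG JF (ϰ.adjoint ⟨conjT JE JH (tp e h), hmem⟩) = _
  rw [LinearPMap.adjoint_apply_eq hϰ.dense ⟨_, hmem⟩ key, conjT_conjT]

/-- If `K† K` has finite trace, then there is an entangling operator with amplitude `K`. It is a
restriction of the closed operator whose graph is cut out by the adjointness relations of
`inner_conjT_flipT`. -/
theorem exists_isEntangling (hμ : IsNFSTrace A μ) (hν : IsNFSTrace B ν)
    (hK : IsAmplitude JG JH JE JF auxE auxF K)
    {ι κ : Type*} {g : ι → G} {h : κ → H}
    (hg : IsTraceFamily (transpose JG A) (stdRep (transpose JG A)) (tildeTrace JG μ) g)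
    (hh : IsTraceFamily (transpose JH B) (stdRep (transpose JH B)) (tildeTrace JH ν) h)
    (hfin : ∑' (i) (l), ‖K (tp (g i) (h l))‖ₑ ^ 2 ≠ ∞) :
    ∃ ϰ : HT G F →ₗ.[ℂ] HT E H, IsEntangling JG JH JF (A := A) (μ := μ) auxF K ϰ := by
  have hfin' : ∑' (l) (i), ‖flipOp K (tp (h l) (g i))‖ₑ ^ 2 ≠ ∞ := by
    rw [ENNReal.tsum_comm]
    simpa only [flipOp_tp, ← ofReal_norm, norm_flipT] using hfin
  have hΦ : ∀ ζ f, IsTraceBounded (transpose JG A) (stdRep (transpose JG A)) (tildeTrace JG μ) ζ →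
      IsTraceBounded B auxF.rep ν f → ∃ Φ, IsTransposeAt JH JF (K ∘L insL ζ) f Φ :=
    fun ζ f hζ hf => exists_isTransposeAt hh (hK.isConjIntertwiner ζ)
      (tsum_enorm_slice_ne_top hK.commutesWithCommutants hg hfin hζ) hf
  have hΨ : ∀ η e, IsTraceBounded (transpose JH B) (stdRep (transpose JH B)) (tildeTrace JH ν) η →
      IsTraceBounded A auxE.rep μ e → ∃ Ψ, IsTransposeAt JG JE (flipOp K ∘L insL η) e Ψ :=
    fun η e hη he => exists_isTransposeAt hg (hK.flip.isConjIntertwiner η)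
      (tsum_enorm_slice_ne_top hK.flip.commutesWithCommutants hh hfin' hη) he
  let s : Set (HT G F) := {x | ∃ (g : G) (f : F),
    IsTraceBounded (transpose JG A) (stdRep (transpose JG A)) (tildeTrace JG μ) g ∧
    IsTraceBounded B auxF.rep ν f ∧ x = tp g f}
  obtain ⟨_, fF, hfF⟩ := auxF.exists_family
  obtain ⟨_, fE, hfE⟩ := auxE.exists_family
  have hdE := dense_boundedVectors hμ.faithful hfE
  have hdF := dense_boundedVectors hν.faithful hfF
  have hdG := dense_boundedVectors (isNFSTrace_transpose JG hμ).faithful hg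
  have hdH := dense_boundedVectors (isNFSTrace_transpose JH hν).faithful hh
  -- the graph of the largest operator formally adjoint to the transposes of the flipped amplitude
  let Γ : Submodule ℂ (HT G F × HT E H) :=
    { carrier := {p | ∀ e η Ψ, IsTransposeAt JG JE (flipOp K ∘L insL η) e Ψ →
        ⟪conjT JG JF (flipT F G Ψ), p.1⟫_ℂ = ⟪tp (JE e) (JH η), p.2⟫_ℂ}
      zero_mem' := fun e η Ψ _ => by simp
      add_mem' := fun {p q} hp hq e η Ψ h => by
        simp only [Prod.fst_add, Prod.snd_add, inner_add_right]
        rw [hp e η Ψ h, hq e η Ψ h]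
      smul_mem' := fun c p hp e η Ψ h => by
        simp only [Prod.smul_fst, Prod.smul_snd, inner_smul_right]
        rw [hp e η Ψ h] }
  have hΓclosed : IsClosed (Γ : Set (HT G F × HT E H)) := by
    change IsClosed {p : HT G F × HT E H |
      ∀ e η Ψ, IsTransposeAt JG JE (flipOp K ∘L insL η) e Ψ →
        ⟪conjT JG JF (flipT F G Ψ), p.1⟫_ℂ = ⟪tp (JE e) (JH η), p.2⟫_ℂ}
    simp only [Set.ofPred_forall]
    refine isClosed_iInter fun e => isClosed_iInter fun η => isClosed_iInter fun Ψ =>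
      isClosed_iInter fun _ => isClosed_eq (by fun_prop) (by fun_prop)
  -- those relations determine `p.2` from `p.1`, as trace-bounded product vectors are total
  have hΓgraph : ∀ p ∈ Γ, p.1 = 0 → p.2 = 0 := by
    intro p hp hp0
    rw [← conjT_conjT JE JH p.2]
    have h0 : conjT JE JH p.2 = 0 := by
      refine eq_zero_of_inner_of_dense (topologicalClosure_span_tp
        (s := (boundedVectors A auxE.rep μ : Set E))
        (t := (boundedVectors (transpose JH B) (stdRep _) (tildeTrace JH ν) : Set H))
        (by rwa [Submodule.span_eq]) (by rwa [Submodule.span_eq])) ?_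
      rintro _ ⟨e, he, η, hη, rfl⟩
      obtain ⟨Ψ, h⟩ := hΨ η e hη he
      have := hp e η Ψ h
      rw [hp0, inner_zero_right] at this
      rw [inner_conjT, ← inner_conj_symm, ← this, map_zero]
    rw [h0, map_zero]
  have hgen : ∀ ζ f Φ, IsTransposeAt JH JF (K ∘L insL ζ) f Φ → (tp ζ f, Φ) ∈ Γ :=
    fun ζ f Φ h e η Ψ hΨ => inner_conjT_flipT hΨ h
  have hgraph := Γ.toLinearPMap_graph_eq hΓgraph
  have hsub : s ⊆ Γ.toLinearPMap.domain := by
    rintro _ ⟨ζ, f, hζ, hf, rfl⟩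
    obtain ⟨Φ, h⟩ := hΦ ζ f hζ hf
    exact ⟨(tp ζ f, Φ), hgen ζ f Φ h, rfl⟩
  have hspan : Submodule.span ℂ s ≤ Γ.toLinearPMap.domain := Submodule.span_le.mpr hsub
  have hval : ∀ {x : HT G F} {y : HT E H}, (x, y) ∈ Γ →
      ∀ hx : x ∈ (Γ.toLinearPMap.domRestrict (Submodule.span ℂ s)).domain,
      Γ.toLinearPMap.domRestrict (Submodule.span ℂ s) ⟨x, hx⟩ = y := by
    intro x y hxy hx
    refine (LinearPMap.domRestrict_apply (y := ⟨x, hx.2⟩) rfl).trans ?_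
    refine Γ.toLinearPMap.mem_graph_snd_inj (x := x) (y := x) ?_ (by rw [hgraph]; exact hxy) rfl
    exact Γ.toLinearPMap.mem_graph ⟨x, hx.2⟩
  refine ⟨Γ.toLinearPMap.domRestrict (Submodule.span ℂ s), ?_, ?_, ?_, ?_⟩
  · rw [LinearPMap.domRestrict_domain, inf_eq_left.mpr hspan]
  · rw [LinearPMap.domRestrict_domain, inf_eq_left.mpr hspan,
      Submodule.dense_iff_topologicalClosure_eq_top]
    have := topologicalClosure_span_tp
      (s := (boundedVectors (transpose JG A) (stdRep _) (tildeTrace JG μ) : Set G))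
      (t := (boundedVectors B auxF.rep ν : Set F))
      (by rwa [Submodule.span_eq]) (by rwa [Submodule.span_eq])
    convert this using 3
    ext x
    exact ⟨fun ⟨ζ, f, hζ, hf, h⟩ => ⟨ζ, hζ, f, hf, h⟩, fun ⟨ζ, hζ, f, hf, h⟩ => ⟨ζ, f, hζ, hf, h⟩⟩
  · refine LinearPMap.isClosable_iff_exists_closed_extension.mpr
      ⟨Γ.toLinearPMap, ?_, LinearPMap.domRestrict_le⟩
    rw [LinearPMap.IsClosed, hgraph]
    exact hΓclosed
  · intro ξ η' ζ η hx
    -- a product vector in the domain has trace-bounded factors, unless it is zero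
    have hΦ' : ∃ Φ, IsTransposeAt JH JF (K ∘L insL ζ) (JF η') Φ := by
      by_cases hζ0 : ζ = 0
      · refine ⟨0, fun ξ η => ?_⟩
        have : (insL ζ : H →L[ℂ] HT G H) = 0 := by
          rw [hζ0, ← zero_smul ℂ (0 : G), insL_smul, zero_smul]
        simp [this]
      by_cases hη0 : η' = 0
      · refine ⟨0, fun ξ η => ?_⟩
        have : tp ξ (JF (JF η')) = 0 := by
          rw [JF.invol, hη0, ← insL_apply, map_zero]
        rw [this]
        simp
      · have hx' : tp ζ (JF η') ∈ Submodule.span ℂ s := hx.1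
        have hη0' : JF η' ≠ 0 := fun h => hη0 (by rw [← JF.invol η', h, map_zero])
        refine hΦ _ _ ?_ ?_
        · have h1 : Submodule.span ℂ s ≤ (boundedVectors (transpose JG A) (stdRep _)
              (tildeTrace JG μ)).comap (insR (JF η')).adjoint.toLinearMap := by
            rw [Submodule.span_le]
            rintro _ ⟨g, f, hg, hf, rfl⟩
            change (insR (JF η')).adjoint (tp g f) ∈ boundedVectors _ _ _
            rw [adjoint_insR_tp]
            exact Submodule.smul_mem _ _ hg
          have h2 := h1 hx'
          change (insR (JF η')).adjoint (tp ζ (JF η')) ∈ boundedVectors _ _ _ at h2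
          rw [adjoint_insR_tp] at h2
          exact (Submodule.smul_mem_iff _ (inner_self_ne_zero.mpr hη0')).mp h2
        · have h1 : Submodule.span ℂ s ≤
              (boundedVectors B auxF.rep ν).comap (insL ζ).adjoint.toLinearMap := by
            rw [Submodule.span_le]
            rintro _ ⟨g, f, hg, hf, rfl⟩
            change (insL ζ).adjoint (tp g f) ∈ boundedVectors _ _ _
            rw [adjoint_insL_tp]
            exact Submodule.smul_mem _ _ hf
          have h2 := h1 hx'
          change (insL ζ).adjoint (tp ζ (JF η')) ∈ boundedVectors _ _ _ at h2
          rw [adjoint_insL_tp] at h2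
          exact (Submodule.smul_mem_iff _ (inner_self_ne_zero.mpr hζ0)).mp h2
    obtain ⟨Φ, h⟩ := hΦ'
    rw [hval (hgen _ _ _ h), h, JF.invol]
    rfl

end Entangling

/-! ### Operators with the same square -/

section Unitary

variable {X Y Z : Type*} [NormedAddCommGroup X] [InnerProductSpace ℂ X] [CompleteSpace X]
  [NormedAddCommGroup Y] [InnerProductSpace ℂ Y] [CompleteSpace Y]
  [NormedAddCommGroup Z] [InnerProductSpace ℂ Z] [CompleteSpace Z]

theorem adjoint_comp_self_ext {P : X →L[ℂ] Y} {Q : X →L[ℂ] Z} (h : ∀ x, ‖P x‖ = ‖Q x‖) :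
    P.adjoint ∘L P = Q.adjoint ∘L Q := by
  have h1 : ∀ x, ⟪(P.adjoint ∘L P) x, x⟫_ℂ = ⟪(Q.adjoint ∘L Q) x, x⟫_ℂ := by
    intro x
    rw [ContinuousLinearMap.comp_apply, ContinuousLinearMap.comp_apply,
      ContinuousLinearMap.adjoint_inner_left, ContinuousLinearMap.adjoint_inner_left,
      inner_self_eq_norm_sq_to_K, inner_self_eq_norm_sq_to_K, h]
  have h2 := (ext_inner_map ((P.adjoint ∘L P : X →L[ℂ] X) : X →ₗ[ℂ] X)
    ((Q.adjoint ∘L Q : X →L[ℂ] X) : X →ₗ[ℂ] X)).mp h1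
  exact ContinuousLinearMap.coe_injective h2

/-- The map of `X` into the closed range of an operator. -/
def toClosedRange (P : X →L[ℂ] Y) :
    X →ₗ[ℂ] (LinearMap.range (P : X →ₗ[ℂ] Y)).topologicalClosure :=
  (P : X →ₗ[ℂ] Y).codRestrict _
    (fun x => Submodule.le_topologicalClosure _ (LinearMap.mem_range_self _ x))

theorem denseRange_toClosedRange (P : X →L[ℂ] Y) : DenseRange (toClosedRange P) := by
  intro y
  rw [closure_subtype, ← Set.range_comp]
  have h : Subtype.val ∘ (toClosedRange P) = P := rfl
  rw [h]
  exact y.2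

/-- Operators with the same square differ by a unitary operator between the closures of their
ranges. -/
theorem unitaryRel_iff {υ : X →L[ℂ] Y} {K : X →L[ℂ] Z} :
    UnitaryRel υ K ↔ K.adjoint ∘L K = υ.adjoint ∘L υ := by
  constructor
  · rintro ⟨U, hU⟩
    refine adjoint_comp_self_ext fun x => ?_
    rw [← hU x]
    exact (U.norm_map ⟨K x, _⟩).symm
  · intro h
    have hn : ∀ x, ‖K x‖ = ‖υ x‖ := norm_eq_of_adjoint_comp_eq h
    have : CompleteSpace (LinearMap.range (υ : X →ₗ[ℂ] Y)).topologicalClosure :=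
      (Submodule.isClosed_topologicalClosure _).completeSpace_coe
    have : CompleteSpace (LinearMap.range (K : X →ₗ[ℂ] Z)).topologicalClosure :=
      (Submodule.isClosed_topologicalClosure _).completeSpace_coe
    let S := (toClosedRange υ).extendOfNorm (toClosedRange K)
    let T := (toClosedRange K).extendOfNorm (toClosedRange υ)
    have hS : ∀ x, S (toClosedRange K x) = toClosedRange υ x :=
      LinearMap.extendOfNorm_eq (denseRange_toClosedRange K)
        ⟨1, fun x => by rw [one_mul]; exact (hn x).ge⟩
    have hT : ∀ x, T (toClosedRange υ x) = toClosedRange K x :=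
      LinearMap.extendOfNorm_eq (denseRange_toClosedRange υ)
        ⟨1, fun x => by rw [one_mul]; exact (hn x).le⟩
    have hTS : ∀ y, T (S y) = y := by
      intro y
      refine (denseRange_toClosedRange K).induction_on (p := fun y => T (S y) = y) y
        (isClosed_eq (by fun_prop) (by fun_prop)) fun x => ?_
      rw [hS, hT]
    have hST : ∀ y, S (T y) = y := by
      intro y
      refine (denseRange_toClosedRange υ).induction_on (p := fun y => S (T y) = y) y
        (isClosed_eq (by fun_prop) (by fun_prop)) fun x => ?_
      rw [hT, hS]
    have hnS : ∀ y, ‖S y‖ = ‖y‖ := by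
      intro y
      refine (denseRange_toClosedRange K).induction_on (p := fun y => ‖S y‖ = ‖y‖) y
        (isClosed_eq (by fun_prop) (by fun_prop)) fun x => ?_
      rw [hS]
      exact (hn x).symm
    refine ⟨{ toLinearEquiv := LinearEquiv.ofLinearMap S.toLinearMap T.toLinearMap
                (LinearMap.ext hST) (LinearMap.ext hTS)
              norm_map' := hnS }, fun x => ?_⟩
    exact congrArg Subtype.val (hS x)

end Unitary

/-! ### Operators determined by their pairings -/

section Vanish

variable {G H : Type*} [NormedAddCommGroup G] [InnerProductSpace ℂ G] [CompleteSpace G]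
  [NormedAddCommGroup H] [InnerProductSpace ℂ H] [CompleteSpace H]
  {M : VonNeumannAlgebra G} {N : VonNeumannAlgebra H}
  {μ : (G →L[ℂ] G) → ℝ≥0∞} {ν : (H →L[ℂ] H) → ℝ≥0∞}

/-- A family implementing a faithful trace is separating. -/
theorem eq_zero_of_tsum_enorm_eq_zero (hν : IsNFSTrace N ν) {κ : Type*} {h : κ → H}
    (hh : IsTraceFamily N (stdRep N) ν h) {t : H →L[ℂ] H} (ht : t ∈ N)
    (h0 : ∀ l, t (h l) = 0) : t = 0 := by
  have ht' : t.adjoint ∘L t ∈ N := mul_mem (star_mem (S := VonNeumannAlgebra H) ht) ht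
  refine eq_zero_of_adjoint_comp_self (hν.faithful _ ht' (adjoint_comp_self_nonneg t) ?_)
  rw [← tsum_enorm_eq_trace hh ht']
  simp [h0]

/-- An element `t` of `N` with `t w = 0` for all `w ∈ N` of finite `ν(w w†)` is zero: otherwise
semifiniteness gives a nonzero `b ≤ t† t` of finite trace, and `w = b^{1/2}` yields `b³ ≤ 0`. -/
theorem eq_zero_of_comp_finite (hν : IsNFSTrace N ν) {κ : Type*} {h : κ → H}
    (hh : IsTraceFamily N (stdRep N) ν h) {t : H →L[ℂ] H} (ht : t ∈ N)
    (h0 : ∀ w ∈ N, ∑' l, ‖w (h l)‖ₑ ^ 2 ≠ ∞ → t ∘L w = 0) : t = 0 := by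
  by_contra hne
  have ht' : t.adjoint ∘L t ∈ N := mul_mem (star_mem (S := VonNeumannAlgebra H) ht) ht
  obtain ⟨b, hb, hb0, hbt, hbne, hbfin⟩ := hν.semifinite _ ht' (adjoint_comp_self_nonneg t)
    (fun h => hne (eq_zero_of_adjoint_comp_self h))
  apply hbne
  set w := CFC.sqrt b with hw
  have hww : w ∘L w = b := CFC.sqrt_mul_sqrt_self b hb0
  have hwadj : w.adjoint = w := adjoint_sqrt b
  have hwN : w ∈ N := sqrt_mem N hb
  have hwfin : ∑' l, ‖w (h l)‖ₑ ^ 2 ≠ ∞ := by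
    rw [hh _ (isIntertwiner_stdRep hwN), hwadj, hww]
    exact hbfin.ne
  have htw := h0 w hwN hwfin
  have h1 : ∀ x, ‖b x‖ ^ 2 ≤ 0 := by
    intro x
    have h2 := ((ContinuousLinearMap.le_def _ _).mp hbt).re_inner_nonneg_right (w x)
    have h3 : t (w x) = 0 := congrArg (fun T => T x) htw
    have h4 : ⟪w x, b (w x)⟫_ℂ = ⟪b x, b x⟫_ℂ := by
      rw [← hww]
      simp only [ContinuousLinearMap.comp_apply]
      rw [← ContinuousLinearMap.adjoint_inner_left, hwadj]
    rw [sub_apply, ContinuousLinearMap.comp_apply, h3, map_zero, zero_sub, inner_neg_right, h4,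
      map_neg, ← norm_sq_eq_re_inner] at h2
    linarith
  ext x
  have := h1 x
  have h3 : ‖b x‖ = 0 := by nlinarith [norm_nonneg (b x)]
  simpa using h3

/-- An operator `T` commuting with `M' ⊗ N'` is determined by the values of `Tr(T(a ⊗ b))`. With
`b = w w'†` of finite trace, cyclicity of the trace in the second factor turns these values into
those of the trace on `M` of `m a` for a bounded `m ∈ M`. Taking `a = m†`, faithfulness of the
trace on `M` gives `m = 0`, and faithfulness in the second factor then gives `T = 0`. -/
theorem eq_zero_of_pairing_eq_zero (hμ : IsNFSTrace M μ) (hν : IsNFSTrace N ν)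
    {ι κ : Type*} {g : ι → G} {h : κ → H} (hg : IsTraceFamily M (stdRep M) μ g)
    (hh : IsTraceFamily N (stdRep N) ν h) {T : HT G H →L[ℂ] HT G H}
    (hT : CommutesWithCommutants M N T)
    (h0 : ∀ a ∈ M, ∀ b ∈ N, ∃ r : ι → ℂ,
      (∀ i, HasSum (fun l => ⟪tp (g i) (h l), T (tp (a (g i)) (b (h l)))⟫_ℂ) (r i)) ∧
      HasSum r 0) : T = 0 := by
  -- the slices of `T` in the first factor vanish
  have key : ∀ w ∈ N, ∀ w' ∈ N, ∑' l, ‖w (h l)‖ₑ ^ 2 ≠ ∞ → ∑' l, ‖w' (h l)‖ₑ ^ 2 ≠ ∞ →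
      ∀ x x', HasSum (fun l => ⟪tp x' (w' (h l)), T (tp x (w (h l)))⟫_ℂ) 0 := by
    intro w hw w' hw' hwf hwf' x x'
    have hsum : Summable fun l => (insR (w' (h l))).adjoint ∘L T ∘L insR (w (h l)) := by
      have h1 := (hasSum_norm_sq hwf).summable
      have h2 := (hasSum_norm_sq hwf').summable
      refine Summable.of_norm_bounded ((h1.add h2).mul_left ‖T‖) fun l => ?_
      have e1 : ‖(insR (w' (h l)) : G →L[ℂ] HT G H).adjoint‖ ≤ ‖w' (h l)‖ := by
        rw [LinearIsometryEquiv.norm_map]; exact norm_insR_le _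
      have e2 : ‖(insR (w (h l)) : G →L[ℂ] HT G H)‖ ≤ ‖w (h l)‖ := norm_insR_le _
      calc ‖(insR (w' (h l))).adjoint ∘L T ∘L insR (w (h l))‖
          ≤ ‖(insR (w' (h l)) : G →L[ℂ] HT G H).adjoint‖ * (‖T‖ *
            ‖(insR (w (h l)) : G →L[ℂ] HT G H)‖) :=
            (ContinuousLinearMap.opNorm_comp_le _ _).trans
              (mul_le_mul_of_nonneg_left (ContinuousLinearMap.opNorm_comp_le _ _)
                (norm_nonneg _))
        _ ≤ ‖w' (h l)‖ * (‖T‖ * ‖w (h l)‖) := by gcongr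
        _ ≤ ‖T‖ * (‖w (h l)‖ ^ 2 + ‖w' (h l)‖ ^ 2) := by
            nlinarith [mul_nonneg (norm_nonneg T) (sq_nonneg (‖w (h l)‖ - ‖w' (h l)‖)),
              mul_nonneg (norm_nonneg T) (add_nonneg (sq_nonneg ‖w (h l)‖)
                (sq_nonneg ‖w' (h l)‖))]
    -- `m` is the partial trace of `(1 ⊗ w'†) T (1 ⊗ w)`, a norm convergent sum of slices
    obtain ⟨m, hm⟩ := hsum
    have hmv : ∀ x x', HasSum (fun l => ⟪tp x' (w' (h l)), T (tp x (w (h l)))⟫_ℂ) ⟪x', m x⟫_ℂ := by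
      intro x x'
      have h1 := hm.mapL ((innerSL ℂ x').comp (ContinuousLinearMap.apply ℂ G x))
      refine h1.congr_fun fun l => ?_
      change _ = ⟪x', (insR (w' (h l))).adjoint (T (insR (w (h l)) x))⟫_ℂ
      rw [ContinuousLinearMap.adjoint_inner_right]
      rfl
    have hmM : m ∈ M := by
      rw [← M.commutant_commutant, VonNeumannAlgebra.mem_commutant_iff]
      intro n hn
      have h1 := hm.mul_left n
      have h2 := hm.mul_right n
      refine h1.unique (h2.congr_fun fun l => ?_)
      exact (VonNeumannAlgebra.mem_commutant_iff.mp hn _ (hT.slice_left _ _)).symm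
    have hm0 : m.adjoint = 0 := by
      have hmM' : m.adjoint ∈ M := star_mem (S := VonNeumannAlgebra G) hmM
      obtain ⟨r, hr, hr0⟩ := h0 m.adjoint hmM' (w ∘L w'.adjoint)
        (mul_mem hw (star_mem (S := VonNeumannAlgebra H) hw'))
      have hri : ∀ i, r i = ⟪g i, m (m.adjoint (g i))⟫_ℂ := by
        intro i
        -- cyclicity of the trace of `N`, polarized
        set t := (insL (g i)).adjoint ∘L T ∘L insL (m.adjoint (g i)) with ht
        have htN : t ∈ N := hT.slice_right _ _
        have htw : t ∘L w ∈ N := mul_mem htN hw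
        have hfin : ∑' l, ‖(t ∘L w) (h l)‖ₑ ^ 2 ≠ ∞ := by
          refine ne_top_of_le_ne_top (ENNReal.mul_ne_top (a := ‖t‖ₑ ^ 2) (by simp) hwf) ?_
          rw [← ENNReal.tsum_mul_left]
          exact ENNReal.tsum_le_tsum fun l => enorm_apply_sq_le _ _
        obtain ⟨S, hS1, hS2⟩ := hasSum_inner_of_tsum_eq_conj (x := fun l => w' (h l))
          (x' := fun l => (t ∘L w) (h l)) (y := fun l => w'.adjoint (h l))
          (y' := fun l => (t ∘L w).adjoint (h l)) hwf' hfin (fun c => by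
            have h1 := tsum_enorm_adjoint hν.tracial hh (w := w' + c • (t ∘L w))
              (add_mem hw' (N.toStarSubalgebra.smul_mem htw c))
            rw [map_add, LinearIsometryEquiv.map_smulₛₗ] at h1
            exact h1.symm)
        have e1 : r i = S := by
          refine (hr i).unique (hS2.congr_fun fun l => ?_)
          rw [ContinuousLinearMap.adjoint_inner_left, ← insL_apply,
            ← ContinuousLinearMap.adjoint_inner_right]
          rfl
        rw [e1]
        refine hS1.unique ((hmv (m.adjoint (g i)) (g i)).congr_fun fun l => ?_)
        exact (insL (g i)).adjoint_inner_right (w' (h l)) _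
      refine eq_zero_of_tsum_enorm_eq_zero hμ hg hmM' fun i => ?_
      have h1 : HasSum (fun i => ‖m.adjoint (g i)‖ ^ 2) 0 := by
        have h2 := hr0.mapL Complex.reCLM
        rw [map_zero] at h2
        refine h2.congr_fun fun i => ?_
        rw [hri i, ← ContinuousLinearMap.adjoint_inner_left, inner_self_eq_norm_sq_to_K]
        simp [← Complex.ofReal_pow]
      have h3 := (hasSum_zero_iff_of_nonneg (fun i => sq_nonneg _)).mp h1
      simpa using congrFun h3 i
    have hm0' : m = 0 := by
      rw [← ContinuousLinearMap.adjoint_adjoint m, hm0, map_zero]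
    have := hmv x x'
    rwa [hm0', zero_apply, inner_zero_right] at this
  -- hence the slices of `T` in the second factor vanish
  refine clm_ext_tp fun x y => ext_inner_tp fun x' y' => ?_
  have htN : (insL x').adjoint ∘L T ∘L insL x ∈ N := hT.slice_right _ _
  have ht0 : (insL x').adjoint ∘L T ∘L insL x = 0 := by
    refine eq_zero_of_comp_finite hν hh htN fun w hw hwf => ?_
    set t := (insL x').adjoint ∘L T ∘L insL x with ht
    have htw : t ∘L w ∈ N := mul_mem htN hw
    have hfin : ∑' l, ‖(t ∘L w) (h l)‖ₑ ^ 2 ≠ ∞ := by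
      refine ne_top_of_le_ne_top (ENNReal.mul_ne_top (a := ‖t‖ₑ ^ 2) (by simp) hwf) ?_
      rw [← ENNReal.tsum_mul_left]
      exact ENNReal.tsum_le_tsum fun l => enorm_apply_sq_le _ _
    refine eq_zero_of_tsum_enorm_eq_zero hν hh htw fun l => ?_
    -- `w' = t w` turns the vanishing sum into a sum of squares
    have h1 := (key w hw (t ∘L w) htw hwf hfin x x').mapL Complex.reCLM
    rw [map_zero] at h1
    have h2 : HasSum (fun l => ‖(t ∘L w) (h l)‖ ^ 2) 0 := by
      refine h1.congr_fun fun l => ?_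
      rw [← insL_apply, ← ContinuousLinearMap.adjoint_inner_right]
      change _ = (⟪(t ∘L w) (h l), (t ∘L w) (h l)⟫_ℂ).re
      rw [inner_self_eq_norm_sq_to_K]
      simp [← Complex.ofReal_pow]
    have h3 := (hasSum_zero_iff_of_nonneg (fun i => sq_nonneg _)).mp h2
    simpa using congrFun h3 l
  have h1 := congrArg (fun t => ⟪y', t y⟫_ℂ) ht0
  rw [ContinuousLinearMap.comp_apply, ContinuousLinearMap.adjoint_inner_right] at h1
  simpa [insL_apply] using h1

end Vanish

/-! ### Entangling operators achieving a compound state -/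

section Achieve

universe u v w z

variable {G : Type u} [NormedAddCommGroup G] [InnerProductSpace ℂ G] [CompleteSpace G]
  {H : Type v} [NormedAddCommGroup H] [InnerProductSpace ℂ H] [CompleteSpace H]
  {E : Type w} [NormedAddCommGroup E] [InnerProductSpace ℂ E] [CompleteSpace E]
  {F : Type z} [NormedAddCommGroup F] [InnerProductSpace ℂ F] [CompleteSpace F]
  {JG : Conjugation G} {JH : Conjugation H} {JE : Conjugation E} {JF : Conjugation F}
  {A : VonNeumannAlgebra G} {μ : (G →L[ℂ] G) → ℝ≥0∞}
  {B : VonNeumannAlgebra H} {ν : (H →L[ℂ] H) → ℝ≥0∞}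
  {auxE : AuxSpace A μ E} {auxF : AuxSpace B ν F} {K : HT G H →L[ℂ] HT E F}

theorem tilde_mem_transpose {a : G →L[ℂ] G} (ha : a ∈ A) : tilde JG a ∈ transpose JG A := by
  rw [mem_transpose, tilde_tilde]
  exact ha

theorem exists_traceFamily_transpose (J : Conjugation H) (hν : IsNFSTrace B ν) :
    ∃ (κ : Type v) (h : κ → H),
      IsTraceFamily (transpose J B) (stdRep (transpose J B)) (tildeTrace J ν) h :=
  (isNFSTrace_transpose J hν).exists_family

theorem tsum_enorm_flipOp {ι κ : Type*} {g : ι → G} {h : κ → H}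
    (hfin : ∑' (i) (l), ‖K (tp (g i) (h l))‖ₑ ^ 2 ≠ ∞) :
    ∑' (l) (i), ‖flipOp K (tp (h l) (g i))‖ₑ ^ 2 ≠ ∞ := by
  rw [ENNReal.tsum_comm]
  simpa only [flipOp_tp, ← ofReal_norm, norm_flipT] using hfin

/-- An entangling operator whose amplitude `K` reproduces the tensor pairings `ω(a ⊗ b)` of
`K† K` achieves `ω`. -/
theorem IsEntangling.achieves (hμ : IsNFSTrace A μ) (hν : IsNFSTrace B ν)
    (hK : IsAmplitude JG JH JE JF auxE auxF K) {ϰ : HT G F →ₗ.[ℂ] HT E H}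
    (hϰ : IsEntangling JG JH JF (A := A) (μ := μ) auxF K ϰ)
    {ω : (HT G H →L[ℂ] HT G H) → ℂ}
    (hω : ∀ a ∈ A, ∀ b ∈ B,
      HasTensorPairing JG JH A μ B ν (K.adjoint ∘L K) a b (ω (opT a b))) :
    Achieves JG JH JE JF auxE auxF ω ϰ := by
  obtain ⟨ι, g, hg⟩ := exists_traceFamily_transpose JG hμ
  obtain ⟨κ, h, hh⟩ := exists_traceFamily_transpose JH hν
  have hfin := tsum_enorm_ne_top_of_pairing (hω 1 (one_mem A) 1 (one_mem B)) hg hh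
  have hfin' := tsum_enorm_flipOp hfin
  have hKc := hK.commutesWithCommutants
  have hKc' := hK.flip.commutesWithCommutants
  have htr : ∀ (e : E) (η : H), IsTraceBounded A auxE.rep μ e →
      IsTraceBounded (transpose JH B) (stdRep (transpose JH B)) (tildeTrace JH ν) η →
      ∃ Ψ, IsTransposeAt JG JE (flipOp K ∘L insL η) e Ψ ∧
        tp e η ∈ (transp JG JH JE JF ϰ).domain ∧
        ev (transp JG JH JE JF ϰ) (tp e η) = flipT F G Ψ := by
    intro e η he hη
    obtain ⟨Ψ, hΨ⟩ := exists_isTransposeAt hg (hK.flip.isConjIntertwiner η)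
      (tsum_enorm_slice_ne_top hKc' hh hfin' hη) he
    obtain ⟨hx, hval⟩ := hϰ.transp_apply (JE := JE) hΨ
    exact ⟨Ψ, hΨ, hx, (ev_of_mem hx).trans hval⟩
  -- the statement over `E` is the one over `F` for the flipped amplitude, as `J ϰ† J` is given by
  -- the partial transposes of the latter
  refine ⟨fun b hb => ⟨partialForm K h (tilde JH b), ?_, ?_, ?_⟩, ?_,
    fun a ha => ⟨partialForm (flipOp K) g (tilde JG a), ?_, ?_, ?_⟩⟩
  · intro κ' f hf g' g₀ hg' hg₀
    exact hasSum_partialForm hK hh hf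
      (fun j => hϰ.isTransposeAt_ev hg₀ (hf.isTraceBounded j))
      (fun j => hϰ.isTransposeAt_ev hg' (hf.isTraceBounded j))
      (tsum_enorm_slice_ne_top hKc hg hfin hg₀) (tsum_enorm_slice_ne_top hKc hg hfin hg') hb
  · exact isDensity_partialForm (isNFSTrace_transpose JG hμ) (isNFSTrace_transpose JH hν) hKc
      hg hh hfin (tilde_mem_transpose hb)
  · exact fun a ha => hasPairing_partialForm (hω a ha b hb) hh
  · intro e η he hη
    obtain ⟨Ψ, -, hx, -⟩ := htr e η he hη
    exact hx
  · intro κ' e he h' h₀ hh' hh₀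
    choose Ψ hΨ _ hev using fun j => htr (e j) h₀ (he.isTraceBounded j) hh₀
    choose Ψ' hΨ' _ hev' using fun j => htr (e j) h' (he.isTraceBounded j) hh'
    have h1 := hasSum_partialForm hK.flip hg he hΨ hΨ'
      (tsum_enorm_slice_ne_top hKc' hh hfin' hh₀) (tsum_enorm_slice_ne_top hKc' hh hfin' hh') ha
    refine h1.congr_fun fun j => ?_
    rw [hev, hev', ← inner_flipT_flipT (flipT F G (Ψ' j)), flipT_flipT]
    congr 1
    have h2 := congrArg (fun T => T (flipT F G (Ψ j)))
      (flipT_opT (G := G) (H := F) a (ContinuousLinearMap.id ℂ F))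
    simp only [ContinuousLinearMap.comp_apply, flipT_flipT] at h2
    exact h2
  · exact isDensity_partialForm (isNFSTrace_transpose JH hν) (isNFSTrace_transpose JG hμ) hKc'
      hh hg hfin' (tilde_mem_transpose ha)
  · intro b hb
    refine hasPairing_partialForm (K := flipOp K) ?_ hg
    rw [adjoint_comp_flipOp]
    exact (hω a ha b hb).flip

/-- If an entangling operator with amplitude `K` achieves the state with density `D`, then
`K† K = D`: the partial traces over `F` reproduce the pairings of `K† K` with all `a ⊗ b`. -/
theorem Achieves.adjoint_comp_eq (hμ : IsNFSTrace A μ) (hν : IsNFSTrace B ν)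
    (hK : IsAmplitude JG JH JE JF auxE auxF K) {ϰ : HT G F →ₗ.[ℂ] HT E H}
    (hϰ : IsEntangling JG JH JF (A := A) (μ := μ) auxF K ϰ)
    {ω : (HT G H →L[ℂ] HT G H) → ℂ} (hach : Achieves JG JH JE JF auxE auxF ω ϰ)
    {D : HT G H →L[ℂ] HT G H}
    (hD : CommutesWithCommutants (transpose JG A) (transpose JH B) D)
    (hω : ∀ a ∈ A, ∀ b ∈ B, HasTensorPairing JG JH A μ B ν D a b (ω (opT a b))) :
    K.adjoint ∘L K = D := by
  have hμ' := isNFSTrace_transpose JG hμ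
  have hν' := isNFSTrace_transpose JH hν
  obtain ⟨ι, g, hg⟩ := exists_traceFamily_transpose JG hμ
  obtain ⟨κ, h, hh⟩ := exists_traceFamily_transpose JH hν
  obtain ⟨κ', f, hf⟩ := auxF.exists_family
  -- `K` has finite trace slices, by the existence of the partial trace at `b = 1`
  have hfin : ∀ ζ, IsTraceBounded (transpose JG A) (stdRep (transpose JG A)) (tildeTrace JG μ) ζ →
      ∑' l, ‖K (tp ζ (h l))‖ₑ ^ 2 ≠ ∞ := by
    intro ζ hζ
    obtain ⟨R, hR, -⟩ := hach.left 1 (one_mem B)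
    have h1 := (hR κ' f hf ζ ζ hζ hζ).mapL Complex.reCLM
    have h2 := tsum_enorm_transpose hf hh (hK.isConjIntertwiner ζ)
      (fun j => hϰ.isTransposeAt_ev hζ (hf.isTraceBounded j))
    have h3 : ∑' l, ‖(K ∘L insL ζ) (h l)‖ₑ ^ 2 ≠ ∞ := by
      rw [← h2]
      refine tsum_enorm_sq_ne_top (h1.summable.congr fun j => ?_)
      have : opT (ContinuousLinearMap.id ℂ E) (1 : H →L[ℂ] H) = ContinuousLinearMap.id ℂ (HT E H) :=
        opT_id
      rw [this, ContinuousLinearMap.id_apply, inner_self_eq_norm_sq_to_K]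
      simp [← Complex.ofReal_pow]
    exact h3
  rw [← sub_eq_zero]
  refine eq_zero_of_pairing_eq_zero hμ' hν' hg hh (hK.commutesWithCommutants.sub hD) ?_
  intro a ha b hb
  have ha' : tilde JG a ∈ A := ha
  have hb' : tilde JH b ∈ B := hb
  obtain ⟨R, hR, -, hpair⟩ := hach.left (tilde JH b) hb'
  have h1 := hpair _ ha' ι g hg
  have h2 := hω _ ha' _ hb' ι g κ h hg hh
  simp only [tilde_tilde, opT_tp] at h1 h2
  have h3 : ∀ i, HasSum (fun l => ⟪tp (g i) (h l), (K.adjoint ∘L K) (tp (a (g i)) (b (h l)))⟫_ℂ)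
      (R (g i) (a (g i))) := by
    intro i
    have hgi := hg.isTraceBounded i
    have hagi := hgi.apply_mem hμ'.tracial hg ha
    have e1 := hR κ' f hf _ _ hgi hagi
    have e2 := hasSum_partialForm hK hh hf
      (fun j => hϰ.isTransposeAt_ev hagi (hf.isTraceBounded j))
      (fun j => hϰ.isTransposeAt_ev hgi (hf.isTraceBounded j)) (hfin _ hagi) (hfin _ hgi) hb'
    have hs : Summable fun l =>
        ⟪K (tp (g i) (h l)), K (tp (a (g i)) (tilde JH (tilde JH b) (h l)))⟫_ℂ := by
      refine summable_inner_of_tsum_ne_top (hfin _ hgi) ?_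
      rw [tilde_tilde]
      exact ne_top_of_le_ne_top (ENNReal.mul_ne_top (by simp) (hfin _ hagi))
        (tsum_enorm_comp_le hν'.tracial hh
          (adjoint_comp_insL_mem hK.commutesWithCommutants _) hb)
    rw [e1.unique e2]
    refine hs.hasSum.congr_fun fun l => ?_
    rw [tilde_tilde, ContinuousLinearMap.comp_apply, ContinuousLinearMap.adjoint_inner_right]
  have h4 : ∀ i, HasSum (fun l => ⟪tp (g i) (h l), D (tp (a (g i)) (b (h l)))⟫_ℂ)
      (∑' l, ⟪tp (g i) (h l), D (tp (a (g i)) (b (h l)))⟫_ℂ) :=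
    fun i => (h2.summable.prod_factor i).hasSum
  refine ⟨fun i => R (g i) (a (g i)) - ∑' l, ⟪tp (g i) (h l), D (tp (a (g i)) (b (h l)))⟫_ℂ,
    fun i => ?_, ?_⟩
  rotate_left
  · have h5 := h1.sub (h2.prod_fiberwise h4)
    rwa [sub_self] at h5
  · refine ((h3 i).sub (h4 i)).congr_fun fun l => ?_
    rw [sub_apply, inner_sub_right]

/-- An element of `Ã ⊗ B̃` is an amplitude for the auxiliary spaces `G` and `H` themselves. -/
theorem isAmplitude_of_mem_vnTensor {hμ : IsNFSTrace A μ} {hν : IsNFSTrace B ν}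
    {K : HT G H →L[ℂ] HT G H} (hK : K ∈ vnTensor (transpose JG A) (transpose JH B)) :
    IsAmplitude JG JH JG JH (AuxSpace.std hμ) (AuxSpace.std hν) K := by
  refine isAmplitude_of_comp_conjOp fun a b => ?_
  exact (commutesWithCommutants_of_mem_vnTensor hK _ (conjOp_mem_commutant_transpose JG A a.2) _
    (conjOp_mem_commutant_transpose JH B b.2)).symm

end Achieve

end Entanglement

end

theorem theorem1
    {G H E F E₀ F₀ : Type*}
    [NormedAddCommGroup G] [InnerProductSpace ℂ G] [CompleteSpace G]
    [NormedAddCommGroup H] [InnerProductSpace ℂ H] [CompleteSpace H]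
    [NormedAddCommGroup E] [InnerProductSpace ℂ E] [CompleteSpace E]
    [NormedAddCommGroup F] [InnerProductSpace ℂ F] [CompleteSpace F]
    [NormedAddCommGroup E₀] [InnerProductSpace ℂ E₀] [CompleteSpace E₀]
    [NormedAddCommGroup F₀] [InnerProductSpace ℂ F₀] [CompleteSpace F₀]
    (JG : Conjugation G) (JH : Conjugation H) (JE₀ : Conjugation E₀) (JF₀ : Conjugation F₀)
    (A : VonNeumannAlgebra G) (μ : (G →L[ℂ] G) → ℝ≥0∞) (hμ : IsNFSTrace A μ)
    (B : VonNeumannAlgebra H) (ν : (H →L[ℂ] H) → ℝ≥0∞) (hν : IsNFSTrace B ν)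
    (υ : HT G H →L[ℂ] HT E F)
    (hυ : υ.adjoint ∘L υ ∈ vnTensor (transpose JG A) (transpose JH B))
    (hτ : HasTensorPairing JG JH A μ B ν (υ.adjoint ∘L υ) 1 1 1)
    (ω : (HT G H →L[ℂ] HT G H) → ℂ) (hω : IsNormalState (vnTensor A B) ω)
    (hωυ : ∀ a ∈ A, ∀ b ∈ B,
      HasTensorPairing JG JH A μ B ν (υ.adjoint ∘L υ) a b (ω (opT a b))) :
    (∃ (K : HT G H →L[ℂ] HT G H) (ϰ : HT G H →ₗ.[ℂ] HT G H),
      IsAmplitude JG JH JG JH (AuxSpace.std hμ) (AuxSpace.std hν) K ∧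
      IsEntangling JG JH JH (A := A) (μ := μ) (AuxSpace.std hν) K ϰ ∧
      Achieves JG JH JG JH (AuxSpace.std hμ) (AuxSpace.std hν) ω ϰ ∧
      UnitaryRel υ K) ∧
    (∀ (auxE : AuxSpace A μ E₀) (auxF : AuxSpace B ν F₀) (K : HT G H →L[ℂ] HT E₀ F₀),
      IsAmplitude JG JH JE₀ JF₀ auxE auxF K →
      (UnitaryRel υ K →
        ∃! ϰ : HT G F₀ →ₗ.[ℂ] HT E₀ H,
          IsEntangling JG JH JF₀ (A := A) (μ := μ) auxF K ϰ) ∧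
      (∀ ϰ : HT G F₀ →ₗ.[ℂ] HT E₀ H,
        IsEntangling JG JH JF₀ (A := A) (μ := μ) auxF K ϰ →
        (Achieves JG JH JE₀ JF₀ auxE auxF ω ϰ ↔ UnitaryRel υ K))) := by
  obtain ⟨ι, g, hg⟩ := exists_traceFamily_transpose JG hμ
  obtain ⟨κ, h, hh⟩ := exists_traceFamily_transpose JH hν
  have hfin := tsum_enorm_ne_top_of_pairing hτ hg hh
  constructor
  · obtain ⟨K, hKm, hKK⟩ := exists_root_mem_centralizer hυ
    have hK := isAmplitude_of_mem_vnTensor (hμ := hμ) (hν := hν) hKm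
    have hKfin : ∑' (i) (l), ‖K (tp (g i) (h l))‖ₑ ^ 2 ≠ ∞ := by
      simpa only [← ofReal_norm, norm_eq_of_adjoint_comp_eq hKK] using hfin
    obtain ⟨ϰ, hϰ⟩ := exists_isEntangling hμ hν hK hg hh hKfin
    refine ⟨_, ϰ, hK, hϰ, hϰ.achieves hμ hν hK ?_, unitaryRel_iff.mpr hKK⟩
    rw [hKK]
    exact hωυ
  · intro auxE auxF K hK
    refine ⟨fun hU => ?_, fun ϰ hϰ => ⟨fun hach => ?_, fun hU => ?_⟩⟩
    · have hn := norm_eq_of_adjoint_comp_eq (unitaryRel_iff.mp hU)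
      obtain ⟨ϰ, hϰ⟩ := exists_isEntangling hμ hν hK hg hh (by
        simpa only [← ofReal_norm, hn] using hfin)
      exact ⟨ϰ, hϰ, fun ϰ' hϰ' => hϰ'.unique hϰ⟩
    · exact unitaryRel_iff.mpr (hach.adjoint_comp_eq hμ hν hK hϰ
        (commutesWithCommutants_of_mem_vnTensor hυ) hωυ)
    · refine hϰ.achieves hμ hν hK ?_
      rw [unitaryRel_iff.mp hU]
      exact hωυ
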